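/- Let $\mathbb K$ be a field, $\lambda\in\mathbb K$, and let $(A,\cdot)$ be an associative (not necessarily unital) $\mathbb K$-algebra. Let $A\oplus_M A$ be the quasi-twilled associative algebra $(A\oplus A,A,A)$ with associative multiplication $$\Omega\big((x,u),(y,v)\big)=(x\cdot v+u\cdot y,\ \lambda\,x\cdot y+u\cdot v),$$ whose second summand is a subalgebra. Place $\mathrm{Hom}(\otimes^{n+1}V,W)$ in degree $n$. Let $[\cdot,\cdot]_G$ be the Gerstenhaber bracket on $\bigoplus_{n\ge0}\mathrm{Hom}(\otimes^{n+1}(A\oplus A),A\oplus A)$, that is, for $f$ of arity $m$ and $g$ of arity $n$, $[f,g]_G=f\circ g-(-1)^{(m-1)(n-1)}g\circ f$ with $$f\circ g(x_1,\dots,x_{m+n-1})=\sum_{i=1}^m(-1)^{(i-1)(n-1)}f(x_1,\dots,x_{i-1},g(x_i,\dots,x_{i+n-1}),x_{i+n},\dots,x_{m+n-1}).$$ Regard $F=\bigoplus_{n\ge 0}\mathrm{Hom}(\otimes^{n+1}A,A)$ as the subspace of those cochains that depend only on the first-summand components of their arguments and take values in the second summand, and let $P$ be the projection onto $F$ that restricts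 the arguments to the first summand and takes the second component of the value. Set $l_0=P\Omega$ and $l_k(f_1,\dots,f_k)=P[\cdots[[\Omega,f_1]_G,f_2]_G,\cdots,f_k]_G$ for $k\ge1$, $f_i\in F$. Then $(F,\{l_k\}_{k\ge 0})$ is a curved $L_\infty$-algebra: the $l_k$ have degree $1$, are graded symmetric, $l_k(x_{\sigma(1)},\dots,x_{\sigma(k)})=\varepsilon(\sigma)l_k(x_1,\dots,x_k)$, and satisfy, for all $n\ge0$ and homogeneous $x_1,\dots,x_n$, $$\sum_{i=0}^n\sum_{\sigma\in S(i,n-i)}\varepsilon(\sigma)\,l_{n-i+1}\big(l_i(x_{\sigma(1)},\dots,x_{\sigma(i)}),x_{\sigma(i+1)},\dots,x_{\sigma(n)}\big)=0,$$ where $S(i,n-i)$ is the set of $(i,n-i)$-shuffles and $\varepsilon(\sigma)$ is the Koszul sign. Moreover $l_0(x,y)=\lambda\,x\cdot y$, $l_1=0$, $l_k=0$ for $k\ge3$, and for $f\in\mathrm{Hom}(\otimes^mA,A)$, $g\in\mathrm{Hom}(\otimes^nA,A)$ with $m,n\ge1$, \begin{align*} l_2(f,g)&(x_1,\dots,x_{m+n})\\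 ={}&(-1)^{m-1}g(x_1,\dots,x_n)\cdot f(x_{n+1},\dots,x_{m+n})+(-1)^{m(n-1)}f(x_1,\dots,x_m)\cdot g(x_{m+1},\dots,x_{m+n})\\ &-\sum_{i=1}^m(-1)^{in}(-1)^m f(x_1,\dots,x_{i-1},x_i\cdot g(x_{i+1},\dots,x_{i+n}),x_{i+n+1},\dots,x_{m+n})\\ &+\sum_{i=1}^m(-1)^{(i-1)n}(-1)^m f(x_1,\dots,x_{i-1},g(x_i,\dots,x_{i+n-1})\cdot x_{i+n},x_{i+n+1},\dots,x_{m+n})\\ &-\sum_{i=1}^n(-1)^{(i-1)m}(-1)^{m(n-1)}g(x_1,\dots,x_{i-1},f(x_i,\dots,x_{i+m-1})\cdot x_{i+m},x_{i+m+1},\dots,x_{m+n})\\ &+\sum_{i=1}^n(-1)^{(i-1)m}(-1)^{mn}g(x_1,\dots,x_{i-1},x_i\cdot f(x_{i+1},\dots,x_{i+m}),x_{i+m+1},\dots,x_{m+n}). \end{align*} If the characteristic of $\mathbb K$ is not $2$, then the Maurer-Cartan elements of this curved $L_\infty$-algebra, i.e. the degree $0$ elements $D$ with $l_0+\sum_{k\ge1}\frac1{k!}l_k(D,\dots,D)=0$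 (where only $l_0+\frac12l_2(D,D)$ can be nonzero), are exactly the modified Rota-Baxter operators of weight $\lambda$ on $A$, i.e. the linear maps $D:A\to A$ with $$D(x)\cdot D(y)-D(x\cdot D(y))-D(D(x)\cdot y)=-\lambda\,x\cdot y\qquad\text{for all }x,y\in A.$$ -/

import Mathlib

set_option maxSynthPendingDepth 3

open scoped DirectSum

noncomputable section

/-! ## Curved `L_∞`-algebras -/

section CurvedLInfty

/-- The Koszul sign `ε(σ; x_1, …, x_n)` for elements `x_a` of degree `d a`: the product of
`(-1)^{|x_{σ(a)}| |x_{σ(b)}|}` over all inversions `a < b`, `σ(b) < σ(a)`. -/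
def koszulSign {n : ℕ} (d : Fin n → ℤ) (σ : Equiv.Perm (Fin n)) : ℤ :=
  ∏ p ∈ Finset.univ.filter (fun p : Fin n × Fin n => p.1 < p.2 ∧ σ p.2 < σ p.1),
    ((d (σ p.1) * d (σ p.2)).negOnePow : ℤ)

/-- `(i, n-i)`-shuffles: `σ(1) < ⋯ < σ(i)` and `σ(i+1) < ⋯ < σ(n)`. -/
def shuffles (n i : ℕ) : Finset (Equiv.Perm (Fin n)) :=
  Finset.univ.filter (fun σ => ∀ a b : Fin n, a < b → (b.val < i ∨ i ≤ a.val) → σ a < σ b)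

variable {K : Type*} [Field K] {g : Type*} [AddCommGroup g] [Module K g]

/-- A curved `L_∞`-algebra: a `ℤ`-graded vector space `g = ⨁ 𝒢 k` with operations
`l k : ⊗^k g → g` of degree `1` that are graded symmetric and satisfy the generalized
Jacobi identities for all `n ≥ 0`. -/
structure IsCurvedLInfty (𝒢 : ℤ → Submodule K g)
    (l : ∀ k : ℕ, MultilinearMap K (fun _ : Fin k => g) g) : Prop where
  graded : DirectSum.IsInternal 𝒢
  degree_one : ∀ (n : ℕ) (d : Fin n → ℤ) (x : Fin n → g), (∀ a, x a ∈ 𝒢 (d a)) →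
    l n x ∈ 𝒢 (∑ a, d a + 1)
  symm : ∀ (n : ℕ) (d : Fin n → ℤ) (x : Fin n → g), (∀ a, x a ∈ 𝒢 (d a)) →
    ∀ σ : Equiv.Perm (Fin n), l n (fun a => x (σ a)) = koszulSign d σ • l n x
  jacobi : ∀ (n : ℕ) (d : Fin n → ℤ) (x : Fin n → g), (∀ a, x a ∈ 𝒢 (d a)) →
    ∑ i : Fin (n + 1), ∑ σ ∈ shuffles n i,
      koszulSign d σ •
        l (n - i + 1) (Fin.cons (α := fun _ => g)
          (l i (fun a : Fin i => x (σ ⟨a, by omega⟩)))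
          (fun b : Fin (n - i) => x (σ ⟨i + b, by omega⟩))) = 0

/-- A Maurer-Cartan element: a degree `0` element `x` with
`l_0 + ∑_{k ≥ 1} (1/k!) l_k(x, …, x) = 0`, the sum having only finitely many nonzero terms. -/
def IsMaurerCartan (𝒢 : ℤ → Submodule K g)
    (l : ∀ k : ℕ, MultilinearMap K (fun _ : Fin k => g) g) (x : g) : Prop :=
  x ∈ 𝒢 0 ∧
  (Function.support
    (fun k : ℕ => (((k + 1).factorial : K)⁻¹) • l (k + 1) (fun _ => x))).Finite ∧
  l 0 ![] + ∑ᶠ k : ℕ, (((k + 1).factorial : K)⁻¹) • l (k + 1) (fun _ => x) = 0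

end CurvedLInfty

/-! ## Cochains and the Gerstenhaber bracket -/

section Cochains

variable (K : Type*) [Field K]
variable (V : Type*) [AddCommGroup V] [Module K V] (W : Type*) [AddCommGroup W] [Module K W]

/-- `Hom(⊗^{n+1} V, W)`, placed in degree `n`. -/
abbrev Cochain (n : ℕ) : Type _ := MultilinearMap K (fun _ : Fin (n + 1) => V) W

/-- `⨁_{n ≥ 0} Hom(⊗^{n+1} V, W)`. -/
abbrev Cochains : Type _ := ⨁ n : ℕ, Cochain K V W n

/-- The `ℤ`-grading of `⨁_{n ≥ 0} Hom(⊗^{n+1} V, W)`: the degree `k` part consists of the elements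
all of whose components outside degree `k` vanish (so it is zero for `k < 0`). -/
def cochainGrading (k : ℤ) : Submodule K (Cochains K V W) where
  carrier := {x | ∀ n : ℕ, (n : ℤ) ≠ k → x n = 0}
  zero_mem' := fun n _ => DirectSum.zero_apply n
  add_mem' := fun {x y} hx hy n hn => by
    rw [DirectSum.add_apply, hx n hn, hy n hn, add_zero]
  smul_mem' := fun c x hx n hn => by
    rw [DirectSum.smul_apply, hx n hn, smul_zero]

variable {V}

/-- The arguments `(x_1, …, x_{i-1}, g(x_i, …, x_{i+n}), x_{i+n+1}, …)` of `f` in a term of `f ∘ g`;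
here positions are counted from `0`, so `i` stands for the mathematical `i - 1`. -/
def insertArgs {m n : ℕ} (i : Fin (m + 1)) (g : (Fin (n + 1) → V) → V)
    (x : Fin (m + n + 1) → V) : Fin (m + 1) → V := fun j =>
  if j < i then x ⟨j, by omega⟩
  else if j = i then g (fun k => x ⟨i + k, by omega⟩)
  else x ⟨j + n, by omega⟩

variable {K}

theorem insertArgs_update {m n : ℕ} (i : Fin (m + 1)) (g : Cochain K V V n)
    (x : Fin (m + n + 1) → V) (p : Fin (m + n + 1)) :
    ∃ (q : Fin (m + 1)) (T : V →ₗ[K] V), ∀ v,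
      insertArgs i g (Function.update x p v)
        = Function.update (insertArgs i g x) q (T v) := by
  rcases lt_or_ge p.val i.val with h1 | h1
  · refine ⟨⟨p, by omega⟩, LinearMap.id, fun v => ?_⟩
    funext j
    by_cases hj : j = ⟨p, by omega⟩
    · subst hj
      have : (⟨p, by omega⟩ : Fin (m + 1)) < i := h1
      simp [insertArgs, this]
    · have hj' : j.val ≠ p.val := fun h => hj (Fin.ext h)
      rw [Function.update_of_ne hj]
      unfold insertArgs
      split_ifs with h2 h3
      · rw [Function.update_of_ne]; simpa [Fin.ext_iff] using hj'
      · congr 1; funext k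
        rw [Function.update_of_ne]; simp only [ne_eq, Fin.ext_iff]; omega
      · rw [Function.update_of_ne]
        simp only [ne_eq, Fin.ext_iff]; simp only [Fin.lt_def, Fin.ext_iff] at h2 h3; omega
  · rcases le_or_gt p.val (i.val + n) with h4 | h4
    · refine ⟨i, g.toLinearMap (fun k => x ⟨i + k, by omega⟩) ⟨p - i, by omega⟩, fun v => ?_⟩
      funext j
      by_cases hj : j = i
      · subst hj
        simp only [insertArgs, lt_irrefl, if_false, if_true, Function.update_self,
          MultilinearMap.toLinearMap_apply]
        congr 1; funext k
        by_cases hk : k = ⟨p - j, by omega⟩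
        · subst hk
          rw [Function.update_self]
          have : (⟨j + (p - j), by omega⟩ : Fin (m + n + 1)) = p := by
            apply Fin.ext; simp only; omega
          simp [this]
        · rw [Function.update_of_ne hk, Function.update_of_ne]
          simp only [Fin.ext_iff, ne_eq] at hk ⊢; omega
      · rw [Function.update_of_ne hj]
        unfold insertArgs
        split_ifs with h2
        · rw [Function.update_of_ne]
          simp only [ne_eq, Fin.ext_iff]; simp only [Fin.lt_def] at h2; omega
        · rw [Function.update_of_ne]
          simp only [ne_eq, Fin.ext_iff]; simp only [Fin.lt_def, Fin.ext_iff] at h2 hj; omega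
    · refine ⟨⟨p - n, by omega⟩, LinearMap.id, fun v => ?_⟩
      funext j
      by_cases hj : j = ⟨p - n, by omega⟩
      · subst hj
        have h5 : ¬ (⟨p - n, by omega⟩ : Fin (m + 1)) < i := by
          simp only [Fin.lt_def]; omega
        have h6 : ¬ (⟨p - n, by omega⟩ : Fin (m + 1)) = i := by
          simp only [Fin.ext_iff]; omega
        have h7 : (⟨p - n + n, by omega⟩ : Fin (m + n + 1)) = p := by
          apply Fin.ext; simp only; omega
        simp [insertArgs, h5, h6, h7]
      · rw [Function.update_of_ne hj]
        simp only [Fin.ext_iff] at hj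
        unfold insertArgs
        split_ifs with h2 h3
        · rw [Function.update_of_ne]
          simp only [ne_eq, Fin.ext_iff]; simp only [Fin.lt_def] at h2; omega
        · congr 1; funext k
          rw [Function.update_of_ne]; simp only [ne_eq, Fin.ext_iff]; omega
        · rw [Function.update_of_ne]
          simp only [ne_eq, Fin.ext_iff]; omega

/-- `(x_1, …) ↦ f(x_1, …, x_{i-1}, g(x_i, …, x_{i+n}), x_{i+n+1}, …)`. -/
def insertCochain {m n : ℕ} (i : Fin (m + 1)) (f : Cochain K V V m) (g : Cochain K V V n) :
    Cochain K V V (m + n) :=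
  MultilinearMap.mk' (fun x => f (insertArgs i g x))
    (fun x p v w => by
      obtain ⟨q, T, h⟩ := insertArgs_update i g x p
      rw [h, h, h, map_add, f.map_update_add])
    (fun x p c v => by
      obtain ⟨q, T, h⟩ := insertArgs_update i g x p
      rw [h, h, map_smul, f.map_update_smul])

theorem insertArgs_eq_update {X : Type*} {m n : ℕ} (i : Fin (m + 1)) (g g' : (Fin (n + 1) → X) → X)
    (x : Fin (m + n + 1) → X) :
    insertArgs i g x
      = Function.update (insertArgs i g' x) i (g (fun k => x ⟨i + k, by omega⟩)) := by
  funext j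
  by_cases hj : j = i
  · subst hj; simp [insertArgs]
  · simp [insertArgs, hj]

/-- The Gerstenhaber composition `f ∘ g` on homogeneous cochains, of degrees `m` and `n`, i.e.
`(f ∘ g)(x_1, …) = ∑_i (-1)^{(i-1) n} f(x_1, …, x_{i-1}, g(x_i, …, x_{i+n}), x_{i+n+1}, …)`. -/
def gerstenhaberComp (m n : ℕ) :
    Cochain K V V m →ₗ[K] Cochain K V V n →ₗ[K] Cochain K V V (m + n) :=
  LinearMap.mk₂ K
    (fun f g => ∑ i : Fin (m + 1), ((-1 : ℤ) ^ (i.val * n)) • insertCochain i f g)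
    (fun f f' g => by
      rw [← Finset.sum_add_distrib]
      refine Finset.sum_congr rfl fun i _ => ?_
      rw [← smul_add]; rfl)
    (fun c f g => by
      rw [Finset.smul_sum]
      refine Finset.sum_congr rfl fun i _ => ?_
      rw [smul_comm c]; rfl)
    (fun f g g' => by
      rw [← Finset.sum_add_distrib]
      refine Finset.sum_congr rfl fun i _ => ?_
      rw [← smul_add]; congr 1; ext x
      change f _ = f _ + f _
      rw [insertArgs_eq_update i _ (fun _ => 0), insertArgs_eq_update i g (fun _ => 0),
        insertArgs_eq_update i g' (fun _ => 0), ← f.map_update_add]; rfl)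
    (fun c f g => by
      rw [Finset.smul_sum]
      refine Finset.sum_congr rfl fun i _ => ?_
      rw [smul_comm c]; congr 1; ext x
      change f _ = c • f _
      rw [insertArgs_eq_update i _ (fun _ => 0), insertArgs_eq_update i g (fun _ => 0),
        ← f.map_update_smul]; rfl)

variable (K V)

/-- The Gerstenhaber bracket `[f, g]_G = f ∘ g - (-1)^{m n} g ∘ f` (for `f`, `g` of degrees
`m`, `n`), extended bilinearly to `⨁_{n ≥ 0} Hom(⊗^{n+1} V, V)`. -/
def gerstenhaberBracket : Cochains K V V →ₗ[K] Cochains K V V →ₗ[K] Cochains K V V :=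
  DirectSum.toModule K ℕ _ fun m =>
    LinearMap.flip <| DirectSum.toModule K ℕ _ fun n => LinearMap.flip <|
      (gerstenhaberComp m n).compr₂ (DirectSum.lof K ℕ (Cochain K V V) (m + n))
        - ((-1 : ℤ) ^ (m * n)) •
          ((gerstenhaberComp n m).compr₂ (DirectSum.lof K ℕ (Cochain K V V) (n + m))).flip

end Cochains

/-! ## Quasi-twilled associative algebras and their derived brackets -/

section QuasiTwilled

/-- A quasi-twilled associative algebra `(A ⊕ A', A, A')`: an associative multiplication on
`A ⊕ A'` for which `A'` is a subalgebra. -/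
structure QuasiTwilledAlgebra (K : Type*) [Field K] (A A' : Type*) [AddCommGroup A] [Module K A]
    [AddCommGroup A'] [Module K A'] where
  mul : (A × A') →ₗ[K] (A × A') →ₗ[K] (A × A')
  mul_assoc : ∀ a b c, mul (mul a b) c = mul a (mul b c)
  mul_right_mem : ∀ u v : A', (mul (0, u) (0, v)).1 = 0

variable {K : Type*} [Field K] {A A' : Type*} [AddCommGroup A] [Module K A]
    [AddCommGroup A'] [Module K A']

variable (K A A') in
/-- The inclusion of `⨁ Hom(⊗^{n+1} A, A')` into `⨁ Hom(⊗^{n+1} (A ⊕ A'), A ⊕ A')` by lifts: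
`f̂((x_1, u_1), …) = (0, f(x_1, …))`. -/
def cochainLift : Cochains K A A' →ₗ[K] Cochains K (A × A') (A × A') :=
  DirectSum.lmap fun n =>
    { toFun := fun f => (LinearMap.inr K A A').compMultilinearMap
        (f.compLinearMap fun _ => LinearMap.fst K A A')
      map_add' := fun f f' => by ext x <;> simp
      map_smul' := fun c f => by ext x <;> simp }

variable (K A A') in
/-- The projection of `⨁ Hom(⊗^{n+1} (A ⊕ A'), A ⊕ A')` onto `⨁ Hom(⊗^{n+1} A, A')`: restrict the
arguments to `A` and take the `A'`-component of the value. -/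
def cochainProj : Cochains K (A × A') (A × A') →ₗ[K] Cochains K A A' :=
  DirectSum.lmap fun n =>
    { toFun := fun h => (LinearMap.snd K A A').compMultilinearMap
        (h.compLinearMap fun _ => LinearMap.inl K A A')
      map_add' := fun f f' => by ext x; simp
      map_smul' := fun c f => by ext x; simp }

namespace QuasiTwilledAlgebra

/-- The multiplication `Ω` of a quasi-twilled algebra, as an element of degree `1` of
`⨁ Hom(⊗^{n+1} (A ⊕ A'), A ⊕ A')`. -/
def delta (Q : QuasiTwilledAlgebra K A A') : Cochains K (A × A') (A × A') :=
  DirectSum.lof K ℕ (Cochain K (A × A') (A × A')) 1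
    (MultilinearMap.mk' (fun x => Q.mul (x 0) (x 1))
      (fun x p v w => by fin_cases p <;> simp)
      (fun x p c v => by fin_cases p <;> simp))

/-- The iterated bracket `(x_1, …, x_k) ↦ [⋯[[Ω, x_1]_G, x_2]_G, ⋯, x_k]_G`. -/
def iteratedBracket (Q : QuasiTwilledAlgebra K A A') : ∀ k : ℕ,
    MultilinearMap K (fun _ : Fin k => Cochains K A A') (Cochains K (A × A') (A × A'))
  | 0 => MultilinearMap.constOfIsEmpty K _ Q.delta
  | k + 1 => MultilinearMap.uncurryRight
      (((gerstenhaberBracket K (A × A')).compl₂ (cochainLift K A A')).compMultilinearMap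
        (iteratedBracket Q k))

/-- The derived brackets `l_k(x_1, …, x_k) = P [⋯[[Ω, x_1]_G, x_2]_G, ⋯, x_k]_G` (with
`l_0 = P Ω`) on `⨁ Hom(⊗^{n+1} A, A')`. -/
def derivedBracket (Q : QuasiTwilledAlgebra K A A') (k : ℕ) :
    MultilinearMap K (fun _ : Fin k => Cochains K A A') (Cochains K A A') :=
  (cochainProj K A A').compMultilinearMap (Q.iteratedBracket k)

end QuasiTwilledAlgebra

end QuasiTwilled

/-! ## Modified Rota-Baxter operators -/

section ModifiedRotaBaxter

variable {K : Type*} [Field K] {A : Type*} [NonUnitalRing A] [Module K A]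

/-- `D(x) D(y) - D(x D(y)) - D(D(x) y) = -λ x y`. -/
def IsModifiedRotaBaxter (lam : K) (D : A →ₗ[K] A) : Prop :=
  ∀ x y : A, D x * D y - D (x * D y) - D (D x * y) = -(lam • (x * y))

variable [IsScalarTower K A A] [SMulCommClass K A A]

variable (A) in
/-- The quasi-twilled associative algebra `A ⊕_M A`, with multiplication
`(x, u) (y, v) = (x v + u y, λ x y + u v)`. -/
def sumM (lam : K) : QuasiTwilledAlgebra K A A where
  mul := LinearMap.mk₂ K
    (fun a b => (a.1 * b.2 + a.2 * b.1, lam • (a.1 * b.1) + a.2 * b.2))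
    (fun a a' b => by
      ext <;> simp only [Prod.fst_add, Prod.snd_add, add_mul, smul_add] <;> abel)
    (fun c a b => by
      ext <;> simp only [Prod.smul_fst, Prod.smul_snd, smul_mul_assoc, smul_add,
        smul_comm c lam])
    (fun a b b' => by
      ext <;> simp only [Prod.fst_add, Prod.snd_add, mul_add, smul_add] <;> abel)
    (fun c a b => by
      ext <;> simp only [Prod.smul_fst, Prod.smul_snd, mul_smul_comm, smul_add,
        smul_comm c lam])
  mul_assoc a b c := by
    ext <;> simp only [LinearMap.mk₂_apply, add_mul, mul_add, smul_add, smul_mul_assoc,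
      mul_smul_comm, mul_assoc] <;> abel
  mul_right_mem u v := by simp

/-- The consecutive entries `(x_s, x_{s+1}, …, x_{s+n-1})` of a sequence. -/
def window (x : ℕ → A) (s n : ℕ) : Fin n → A := fun k => x (s + k)

/-- `(x_1, …, x_{i-1}, a, x_{i+r+1}, x_{i+r+2}, …)`, a tuple of length `m`. -/
def replaceBlock (x : ℕ → A) (i : ℕ) (a : A) (r m : ℕ) : Fin m → A := fun k =>
  if k.val + 1 < i then x (k + 1) else if k.val + 1 = i then a else x (k + 1 + r)

/-- The value at `(x_1, …, x_{m+n})` of the explicit binary bracket of `f ∈ Hom(⊗^m A, A)` and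
`g ∈ Hom(⊗^n A, A)`. -/
def explicitL2 {m n : ℕ} (f : (Fin m → A) → A) (g : (Fin n → A) → A) (x : ℕ → A) : A :=
  (-1 : ℤ) ^ (m - 1) • (g (window x 1 n) * f (window x (n + 1) m))
  + (-1 : ℤ) ^ (m * (n - 1)) • (f (window x 1 m) * g (window x (m + 1) n))
  - ∑ i ∈ Finset.Icc 1 m, ((-1 : ℤ) ^ (i * n) * (-1) ^ m) •
      f (replaceBlock x i (x i * g (window x (i + 1) n)) n m)
  + ∑ i ∈ Finset.Icc 1 m, ((-1 : ℤ) ^ ((i - 1) * n) * (-1) ^ m) •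
      f (replaceBlock x i (g (window x i n) * x (i + n)) n m)
  - ∑ i ∈ Finset.Icc 1 n, ((-1 : ℤ) ^ ((i - 1) * m) * (-1) ^ (m * (n - 1))) •
      g (replaceBlock x i (f (window x i m) * x (i + m)) m n)
  + ∑ i ∈ Finset.Icc 1 n, ((-1 : ℤ) ^ ((i - 1) * m) * (-1) ^ (m * n)) •
      g (replaceBlock x i (x i * f (window x (i + 1) m)) m n)

end ModifiedRotaBaxter

end

/-! The argument is Voronov's derived bracket construction, with one simplification special to `A
⊕_M A`. The Gerstenhaber composition is right pre-Lie: its associator consists of the terms in which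
two cochains are inserted at disjoint places, and these are graded symmetric. Hence `[·,·]_G` is a
graded Lie bracket, and an odd `x` with `x ∘ x = 0` gives a differential `[x, ·]`.

Lifted cochains read only first components and take values in the second summand, so the composition
of two of them is zero and `F` is abelian. Write `Ω = Ω₀ + λ μ̂`, where `Ω₀` has weight `0` and `μ̂`
is the lift of the product `μ` of `A` (`delta_sumM`). All brackets with `k ≥ 1` then see only `Ω₀`.
Moreover `P Ω₀ = 0`, `P [Ω₀, f] = 0`, and `[[Ω₀, f], g]` already lies in `F`
(`cochainLift_binaryBracket`). Thus `l_0 = λ μ`, `l_1 = 0`, `l_2(f, g) = [[Ω₀, f], g]`, and one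
further bracket with `F` gives zero.

Only two generalized Jacobi identities have nonzero terms. For `n = 1` the identity is `l_2(l_0, x)
= 0`, which follows from `[Ω₀, μ̂] = 0`; for `n = 3` it is the graded Jacobi identity of `l_2`
(`binaryBracket_jacobi`). For a linear map `D`, the explicit formula makes `l_2(D, D)` twice the
left side of the Rota-Baxter identity, and this factor cancels the `1/2` of the Maurer-Cartan
equation. -/

/-! ### Evaluation on sequences, and the associator of the Gerstenhaber composition -/

section EvalSeq

variable {K : Type*} [Field K] {V : Type*} [AddCommGroup V] [Module K V]
  {W : Type*} [AddCommGroup W] [Module K W]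

/-- The value of an `(n+1)`-ary cochain at the first `n + 1` entries of a sequence. -/
def evalSeq {n : ℕ} (f : Cochain K V W n) (s : ℕ → V) : W := f (fun k => s k)

theorem evalSeq_ext {n : ℕ} {f g : Cochain K V W n} (h : ∀ s, evalSeq f s = evalSeq g s) :
    f = g := by
  ext x
  have := h (fun k => if hk : k < n + 1 then x ⟨k, hk⟩ else 0)
  have e : (fun k : Fin (n + 1) => if hk : k.val < n + 1 then x ⟨k, hk⟩ else 0) = x :=
    funext fun k => dif_pos k.2
  rwa [evalSeq, evalSeq, e] at this

theorem evalSeq_congr {n : ℕ} (f : Cochain K V W n) {s t : ℕ → V} (h : ∀ k ≤ n, s k = t k) :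
    evalSeq f s = evalSeq f t :=
  congrArg f (funext fun k => h k (by omega))

/-- The sequence `(s_0, …, s_{i-1}, v, s_{i+n+1}, s_{i+n+2}, …)`. -/
def insertSeq {X : Type*} (i n : ℕ) (v : X) (s : ℕ → X) : ℕ → X := fun k =>
  if k < i then s k else if k = i then v else s (k + n)

theorem evalSeq_insertSeq {m i : ℕ} (hi : i < m + 1) (n : ℕ) (f : Cochain K V W m) (v : V)
    (s : ℕ → V) :
    evalSeq f (insertSeq i n v s)
      = f.toLinearMap (fun k => insertSeq i n 0 s k) ⟨i, hi⟩ v := by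
  rw [MultilinearMap.toLinearMap_apply, evalSeq]
  congr 1
  funext k
  by_cases hk : k = ⟨i, hi⟩
  · subst hk; simp [insertSeq]
  · have : k.val ≠ i := fun h => hk (Fin.ext h)
    simp [insertSeq, hk, this]

theorem evalSeq_insertSeq_zero {m i : ℕ} (hi : i < m + 1) (n : ℕ) (f : Cochain K V W m)
    (s : ℕ → V) : evalSeq f (insertSeq i n 0 s) = 0 := by
  rw [evalSeq_insertSeq hi, map_zero]

theorem evalSeq_insertSeq_add {m i : ℕ} (hi : i < m + 1) (n : ℕ) (f : Cochain K V W m)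
    (v w : V) (s : ℕ → V) :
    evalSeq f (insertSeq i n (v + w) s)
      = evalSeq f (insertSeq i n v s) + evalSeq f (insertSeq i n w s) := by
  simp only [evalSeq_insertSeq hi, map_add]

theorem evalSeq_insertSeq_zsmul {m i : ℕ} (hi : i < m + 1) (n : ℕ) (f : Cochain K V W m)
    (c : ℤ) (v : V) (s : ℕ → V) :
    evalSeq f (insertSeq i n (c • v) s) = c • evalSeq f (insertSeq i n v s) := by
  simp only [evalSeq_insertSeq hi, map_zsmul]

theorem evalSeq_insertSeq_sum {m i : ℕ} (hi : i < m + 1) (n : ℕ) (f : Cochain K V W m)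
    {ι : Type*} (S : Finset ι) (c : ι → ℤ) (v : ι → V) (s : ℕ → V) :
    evalSeq f (insertSeq i n (∑ k ∈ S, c k • v k) s)
      = ∑ k ∈ S, c k • evalSeq f (insertSeq i n (v k) s) := by
  simp only [evalSeq_insertSeq hi, map_sum, map_zsmul]

theorem evalSeq_insertCochain {m n : ℕ} (i : Fin (m + 1)) (f : Cochain K V V m)
    (g : Cochain K V V n) (s : ℕ → V) :
    evalSeq (insertCochain i f g) s
      = evalSeq f (insertSeq i n (evalSeq g fun k => s (i + k)) s) := by
  change f _ = f _
  congr 1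
  funext j
  simp only [insertArgs, insertSeq, Fin.lt_def, Fin.ext_iff]
  rfl

theorem evalSeq_gerstenhaberComp {m n : ℕ} (f : Cochain K V V m) (g : Cochain K V V n)
    (s : ℕ → V) :
    evalSeq (gerstenhaberComp m n f g) s = ∑ i ∈ Finset.range (m + 1),
      ((-1 : ℤ) ^ (i * n)) • evalSeq f (insertSeq i n (evalSeq g fun k => s (i + k)) s) := by
  rw [Finset.sum_range]
  simp only [← evalSeq_insertCochain]
  simp [gerstenhaberComp, evalSeq]

/-- The terms of `(f ∘ g) ∘ h` in which `h` is inserted to the left of `g`. -/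
def disjointInsertions {m n p : ℕ} (f : Cochain K V V m) (g : Cochain K V V n)
    (h : Cochain K V V p) (s : ℕ → V) : V :=
  ∑ i ∈ Finset.range (m + 1), ∑ j ∈ Finset.range i, ((-1 : ℤ) ^ (j * p + i * n)) •
    evalSeq f (insertSeq i n (evalSeq g fun k => s (i + p + k))
      (insertSeq j p (evalSeq h fun k => s (j + k)) s))

/-- The entry `w` lies inside the block that the outer insertion replaces, so it disappears. -/
theorem insertSeq_nested {X : Type*} (i n k p : ℕ) (hk : k ≤ n) (v w : X) (s : ℕ → X) :
    insertSeq i n v (insertSeq (i + k) p w s) = insertSeq i (n + p) v s := by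
  funext t
  simp only [insertSeq]
  split_ifs <;> first | rfl | (exfalso; omega) | (congr 1; omega)

theorem insertSeq_comm {X : Type*} (i n j p : ℕ) (hij : i < j) (v w : X) (s : ℕ → X) :
    insertSeq i n v (insertSeq (j + n) p w s) = insertSeq j p w (insertSeq i n v s) := by
  funext t
  simp only [insertSeq]
  split_ifs <;> first | rfl | (exfalso; omega) | (congr 1; omega)

/-- The associator of the Gerstenhaber composition consists of the disjoint insertions. -/
theorem evalSeq_gerstenhaberComp_assoc {m n p : ℕ} (f : Cochain K V V m) (g : Cochain K V V n)
    (h : Cochain K V V p) (s : ℕ → V) :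
    evalSeq (gerstenhaberComp (m + n) p (gerstenhaberComp m n f g) h) s
      = evalSeq (gerstenhaberComp m (n + p) f (gerstenhaberComp n p g h)) s
        + disjointInsertions f g h s + ((-1 : ℤ) ^ (n * p)) • disjointInsertions f h g s := by
  -- Fix the place `i` of `g` in `f`. The places `j` of `h` in `f ∘ g` fall into three ranges: left
  -- of the block of `g`, the `n + 1` places inside it, and right of it. These give the nested
  -- composition and the two kinds of disjoint insertions.
  have key : ∀ i ∈ Finset.range (m + 1), ∑ j ∈ Finset.range (m + n + 1),
      ((-1 : ℤ) ^ (j * p + i * n)) • evalSeq f (insertSeq i n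
        (evalSeq g fun k => insertSeq j p (evalSeq h fun k => s (j + k)) s (i + k))
        (insertSeq j p (evalSeq h fun k => s (j + k)) s))
      = ((-1 : ℤ) ^ (i * (n + p))) • evalSeq f (insertSeq i (n + p)
          (evalSeq (gerstenhaberComp n p g h) fun k => s (i + k)) s)
        + ∑ j ∈ Finset.range i, ((-1 : ℤ) ^ (j * p + i * n)) •
          evalSeq f (insertSeq i n (evalSeq g fun k => s (i + p + k))
            (insertSeq j p (evalSeq h fun k => s (j + k)) s))
        + ∑ j ∈ Finset.range (m + 1), if i < j then ((-1 : ℤ) ^ (n * p)) •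
            ((-1 : ℤ) ^ (i * n + j * p)) •
            evalSeq f (insertSeq j p (evalSeq h fun k => s (j + n + k))
              (insertSeq i n (evalSeq g fun k => s (i + k)) s)) else 0 := by
    intro i hi
    rw [Finset.mem_range] at hi
    have e1 : m + n + 1 = i + ((n + 1) + (m - i)) := by omega
    have e2 : m + 1 = (i + 1) + (m - i) := by omega
    rw [e1, Finset.sum_range_add, Finset.sum_range_add, e2, Finset.sum_range_add _ (i + 1),
      Finset.sum_eq_zero (s := Finset.range (i + 1)), zero_add, ← add_assoc,
      add_comm (∑ j ∈ Finset.range i, _)]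
    · congr 1
      · congr 1
        · rw [evalSeq_gerstenhaberComp, evalSeq_insertSeq_sum hi, Finset.smul_sum]
          refine Finset.sum_congr rfl fun k hk => ?_
          rw [Finset.mem_range] at hk
          rw [insertSeq_nested i n k p (by omega), smul_smul, ← pow_add]
          congr 1
          · congr 1; ring
          · congr 2
            refine evalSeq_congr _ fun t _ => ?_
            simp only [insertSeq]
            split_ifs <;> first
              | (exfalso; omega)
              | (congr 1; omega)
              | (simp only [add_assoc])
        · refine Finset.sum_congr rfl fun j hj => ?_
          rw [Finset.mem_range] at hj
          congr 3
          refine evalSeq_congr _ fun t _ => ?_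
          simp only [insertSeq]
          rw [if_neg (by omega), if_neg (by omega)]
          congr 1; omega
      · refine Finset.sum_congr rfl fun k hk => ?_
        rw [Finset.mem_range] at hk
        have e3 : i + (n + 1 + k) = (i + 1 + k) + n := by ring
        rw [if_pos (by omega), e3, insertSeq_comm _ _ _ _ (by omega), smul_smul, ← pow_add]
        congr 1
        · congr 1; ring
        · congr 2
          congr 1
          refine evalSeq_congr _ fun t _ => ?_
          simp only [insertSeq]
          rw [if_pos (by omega)]
    · intro j hj
      rw [Finset.mem_range] at hj
      rw [if_neg (by omega)]
  -- Exchanging the two summations puts the terms with `h` to the right of `g` in the shape that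
  -- `key` produces.
  have hS : ((-1 : ℤ) ^ (n * p)) • disjointInsertions f h g s
      = ∑ i ∈ Finset.range (m + 1), ∑ j ∈ Finset.range (m + 1), if i < j then
          ((-1 : ℤ) ^ (n * p)) • ((-1 : ℤ) ^ (i * n + j * p)) •
            evalSeq f (insertSeq j p (evalSeq h fun k => s (j + n + k))
              (insertSeq i n (evalSeq g fun k => s (i + k)) s)) else 0 := by
    rw [disjointInsertions, Finset.sum_comm, Finset.smul_sum]
    refine Finset.sum_congr rfl fun j hj => ?_
    rw [Finset.mem_range] at hj
    rw [← Finset.sum_filter, Finset.smul_sum]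
    refine Finset.sum_congr ?_ fun _ _ => rfl
    ext i
    simp only [Finset.mem_range, Finset.mem_filter]
    omega
  rw [hS, evalSeq_gerstenhaberComp f, disjointInsertions, ← Finset.sum_add_distrib,
    ← Finset.sum_add_distrib, ← Finset.sum_congr rfl key, Finset.sum_comm,
    evalSeq_gerstenhaberComp]
  refine Finset.sum_congr rfl fun j _ => ?_
  rw [evalSeq_gerstenhaberComp, Finset.smul_sum]
  refine Finset.sum_congr rfl fun i _ => ?_
  rw [smul_smul, ← pow_add]

end EvalSeq

/-! ### The grading of the cochain space, and componentwise comparison -/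

section Grading

variable {K : Type*} [Field K] {V : Type*} [AddCommGroup V] [Module K V]
  {W : Type*} [AddCommGroup W] [Module K W]

theorem lof_mem_cochainGrading {n : ℕ} {d : ℤ} (h : (n : ℤ) = d) (f : Cochain K V W n) :
    DirectSum.lof K ℕ (Cochain K V W) n f ∈ cochainGrading K V W d := by
  intro k hk
  rw [DirectSum.lof_eq_of, DirectSum.of_eq_of_ne]
  rintro rfl
  exact hk h

theorem mem_cochainGrading_natCast {n : ℕ} {x : Cochains K V W} :
    x ∈ cochainGrading K V W n ↔ ∃ f, x = DirectSum.lof K ℕ (Cochain K V W) n f := by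
  constructor
  · intro hx
    refine ⟨x n, ?_⟩
    refine DFinsupp.ext fun k => ?_
    by_cases hk : k = n
    · subst hk
      exact (DirectSum.lof_apply K k (x k)).symm
    · have h1 : x k = 0 := hx k (by exact_mod_cast hk)
      have h2 := lof_mem_cochainGrading (n := n) rfl (x n) k (by exact_mod_cast hk)
      exact h1.trans h2.symm
  · rintro ⟨f, rfl⟩
    exact lof_mem_cochainGrading rfl f

theorem eq_zero_of_mem_cochainGrading {d : ℤ} (hd : d < 0) {x : Cochains K V W}
    (hx : x ∈ cochainGrading K V W d) : x = 0 :=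
  DFinsupp.ext fun k => hx k (by omega)

/-- Degrees such as `m + n + p` and `m + (n + p)` are not definitionally equal; comparing values on
sequences avoids transporting cochains between them. -/
theorem lof_congr {m n : ℕ} (h : m = n) {f : Cochain K V W m} {g : Cochain K V W n}
    (hfg : ∀ s, evalSeq f s = evalSeq g s) :
    DirectSum.lof K ℕ (Cochain K V W) m f = DirectSum.lof K ℕ (Cochain K V W) n g := by
  subst h
  rw [evalSeq_ext hfg]

/-- The value of the `(N+1)`-ary component at the first `N + 1` entries of a sequence. -/
def componentEval (N : ℕ) (s : ℕ → V) : Cochains K V W →ₗ[K] W where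
  toFun x := evalSeq (x N) s
  map_add' x y := by rw [DirectSum.add_apply]; rfl
  map_smul' c x := by rw [DirectSum.smul_apply]; rfl

theorem cochains_ext {x y : Cochains K V W}
    (h : ∀ N s, componentEval N s x = componentEval N s y) : x = y :=
  DFinsupp.ext fun N => evalSeq_ext (h N)

theorem componentEval_lof {n : ℕ} (f : Cochain K V W n) (N : ℕ) (s : ℕ → V) :
    componentEval N s (DirectSum.lof K ℕ (Cochain K V W) n f)
      = if n = N then evalSeq f s else 0 := by
  split_ifs with h
  · subst h
    exact congrArg (evalSeq · s) (DirectSum.lof_apply K n f)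
  · exact congrArg (evalSeq · s) (lof_mem_cochainGrading rfl f N (by exact_mod_cast Ne.symm h))

theorem isInternal_cochainGrading : DirectSum.IsInternal (cochainGrading K V W) := by
  constructor
  · rw [injective_iff_map_eq_zero]
    intro y hy
    refine DFinsupp.ext fun d => Subtype.ext ?_
    refine DFinsupp.ext fun n => ?_
    by_cases hn : (n : ℤ) = d
    · subst hn
      -- Each summand `z e` is concentrated in component `e`, so component `n` of the sum comes from
      -- `z n` alone.
      have key : ∀ z : ⨁ d : ℤ, cochainGrading K V W d,
          (DirectSum.coeAddMonoidHom (cochainGrading K V W) z) n = (z n : Cochains K V W) n := by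
        intro z
        induction z using DirectSum.induction_on with
        | zero => simp
        | of e w =>
          rw [DirectSum.coeAddMonoidHom_of]
          by_cases he : e = n
          · subst he; rw [DirectSum.of_eq_same]
          · rw [DirectSum.of_eq_of_ne _ _ _ (Ne.symm he)]
            exact w.2 n (Ne.symm he)
        | add z w hz hw => 
          rw [map_add, DirectSum.add_apply, hz, hw, DirectSum.add_apply, Submodule.coe_add,
            DirectSum.add_apply]
      have := key y
      rw [hy] at this
      exact this.symm
    · exact (y d).2 n hn
  · intro x
    induction x using DirectSum.induction_on with
    | zero => exact ⟨0, map_zero _⟩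
    | of n f =>
      exact ⟨DirectSum.of (fun d : ℤ => cochainGrading K V W d) n
        ⟨_, lof_mem_cochainGrading rfl f⟩, DirectSum.coeAddMonoidHom_of _ _ _⟩
    | add x y hx hy =>
      obtain ⟨a, rfl⟩ := hx
      obtain ⟨b, rfl⟩ := hy
      exact ⟨a + b, map_add _ _ _⟩

end Grading

/-! ### The pre-Lie identity and the graded Lie bracket -/

section Composition

variable {K : Type*} [Field K] {V : Type*} [AddCommGroup V] [Module K V]

variable (K V) in
/-- The Gerstenhaber composition, extended bilinearly to `⨁_{n ≥ 0} Hom(⊗^{n+1} V, V)`. -/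
noncomputable def cochainsComp : Cochains K V V →ₗ[K] Cochains K V V →ₗ[K] Cochains K V V :=
  DirectSum.toModule K ℕ _ fun m =>
    LinearMap.flip <| DirectSum.toModule K ℕ _ fun n => LinearMap.flip <|
      (gerstenhaberComp m n).compr₂ (DirectSum.lof K ℕ (Cochain K V V) (m + n))

theorem cochainsComp_lof {m n : ℕ} (f : Cochain K V V m) (g : Cochain K V V n) :
    cochainsComp K V (DirectSum.lof K ℕ (Cochain K V V) m f)
      (DirectSum.lof K ℕ (Cochain K V V) n g)
      = DirectSum.lof K ℕ (Cochain K V V) (m + n) (gerstenhaberComp m n f g) := by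
  simp [cochainsComp]

variable {m n p : ℕ} {x y z : Cochains K V V}

theorem cochainsComp_mem (hx : x ∈ cochainGrading K V V m) (hy : y ∈ cochainGrading K V V n) :
    cochainsComp K V x y ∈ cochainGrading K V V (m + n : ℕ) := by
  obtain ⟨f, rfl⟩ := mem_cochainGrading_natCast.1 hx
  obtain ⟨g, rfl⟩ := mem_cochainGrading_natCast.1 hy
  rw [cochainsComp_lof]
  exact lof_mem_cochainGrading rfl _

theorem gerstenhaberBracket_eq (hx : x ∈ cochainGrading K V V m)
    (hy : y ∈ cochainGrading K V V n) :
    gerstenhaberBracket K V x y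
      = cochainsComp K V x y - ((-1 : ℤ) ^ (m * n)) • cochainsComp K V y x := by
  obtain ⟨f, rfl⟩ := mem_cochainGrading_natCast.1 hx
  obtain ⟨g, rfl⟩ := mem_cochainGrading_natCast.1 hy
  simp [cochainsComp_lof, gerstenhaberBracket]

theorem gerstenhaberBracket_mem (hx : x ∈ cochainGrading K V V m)
    (hy : y ∈ cochainGrading K V V n) :
    gerstenhaberBracket K V x y ∈ cochainGrading K V V (m + n : ℕ) := by
  rw [gerstenhaberBracket_eq hx hy]
  refine sub_mem (cochainsComp_mem hx hy) (zsmul_mem ?_ _)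
  rw [add_comm]
  exact cochainsComp_mem hy hx

theorem gerstenhaberBracket_antisymm (hx : x ∈ cochainGrading K V V m)
    (hy : y ∈ cochainGrading K V V n) :
    gerstenhaberBracket K V x y = -((-1 : ℤ) ^ (m * n)) • gerstenhaberBracket K V y x := by
  rw [gerstenhaberBracket_eq hx hy, gerstenhaberBracket_eq hy hx, mul_comm n m]
  rcases neg_one_pow_eq_or ℤ (m * n) with h | h <;> rw [h] <;> module

/-- The Gerstenhaber composition is a graded right pre-Lie product. -/
theorem cochainsComp_preLie (hx : x ∈ cochainGrading K V V m)
    (hy : y ∈ cochainGrading K V V n) (hz : z ∈ cochainGrading K V V p) :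
    cochainsComp K V (cochainsComp K V x y) z - cochainsComp K V x (cochainsComp K V y z)
      = ((-1 : ℤ) ^ (n * p)) • (cochainsComp K V (cochainsComp K V x z) y
        - cochainsComp K V x (cochainsComp K V z y)) := by
  obtain ⟨f, rfl⟩ := mem_cochainGrading_natCast.1 hx
  obtain ⟨g, rfl⟩ := mem_cochainGrading_natCast.1 hy
  obtain ⟨h, rfl⟩ := mem_cochainGrading_natCast.1 hz
  simp only [cochainsComp_lof]
  have e1 : DirectSum.lof K ℕ (Cochain K V V) (m + n + p)
        (gerstenhaberComp (m + n) p (gerstenhaberComp m n f g) h)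
      = DirectSum.lof K ℕ (Cochain K V V) (m + (n + p))
          (gerstenhaberComp m (n + p) f (gerstenhaberComp n p g h))
        + ((-1 : ℤ) ^ (n * p)) • (DirectSum.lof K ℕ (Cochain K V V) (m + p + n)
        (gerstenhaberComp (m + p) n (gerstenhaberComp m p f h) g)
       - DirectSum.lof K ℕ (Cochain K V V) (m + (p + n))
          (gerstenhaberComp m (p + n) f (gerstenhaberComp p n h g))) := by
    refine cochains_ext fun N s => ?_
    simp only [map_add, map_sub, map_zsmul, componentEval_lof, evalSeq_gerstenhaberComp_assoc,
      add_assoc, add_comm p n]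
    split_ifs
    · rw [mul_comm p n]
      rcases neg_one_pow_eq_or ℤ (n * p) with h | h <;> rw [h] <;> module
    · simp
  rw [e1]; abel

/-- For equal odd arguments the two families of disjoint insertions cancel. The pre-Lie identity
would give only twice this equation, which says nothing in characteristic `2`. -/
theorem cochainsComp_sq_of_odd (hx : x ∈ cochainGrading K V V m)
    (hy : y ∈ cochainGrading K V V n) (hn : Odd n) :
    cochainsComp K V (cochainsComp K V x y) y = cochainsComp K V x (cochainsComp K V y y) := by
  obtain ⟨f, rfl⟩ := mem_cochainGrading_natCast.1 hx
  obtain ⟨g, rfl⟩ := mem_cochainGrading_natCast.1 hy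
  simp only [cochainsComp_lof]
  refine lof_congr (add_assoc _ _ _) fun s => ?_
  rw [evalSeq_gerstenhaberComp_assoc, (hn.mul hn).neg_one_pow]
  module

/-- A signed combination of three pre-Lie identities, one for each choice of the leftmost factor. -/
theorem gerstenhaberBracket_jacobi (hx : x ∈ cochainGrading K V V m)
    (hy : y ∈ cochainGrading K V V n) (hz : z ∈ cochainGrading K V V p) :
    gerstenhaberBracket K V x (gerstenhaberBracket K V y z)
      = gerstenhaberBracket K V (gerstenhaberBracket K V x y) z
        - ((-1 : ℤ) ^ (n * p)) • gerstenhaberBracket K V (gerstenhaberBracket K V x z) y := by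
  have h1 := cochainsComp_preLie hx hy hz
  have h2 := cochainsComp_preLie hy hx hz
  have h3 := cochainsComp_preLie hz hx hy
  rw [gerstenhaberBracket_eq hx (gerstenhaberBracket_mem hy hz),
    gerstenhaberBracket_eq (gerstenhaberBracket_mem hx hy) hz,
    gerstenhaberBracket_eq (gerstenhaberBracket_mem hx hz) hy,
    gerstenhaberBracket_eq hx hy, gerstenhaberBracket_eq hy hz, gerstenhaberBracket_eq hx hz]
  simp only [map_sub, map_zsmul, LinearMap.sub_apply, LinearMap.smul_apply, mul_add, add_mul,
    pow_add, mul_comm p n] at h1 h2 h3 ⊢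
  have a := neg_one_pow_eq_or ℤ (m * n)
  have b := neg_one_pow_eq_or ℤ (m * p)
  have c := neg_one_pow_eq_or ℤ (n * p)
  linear_combination (norm := skip)
    (-1 : ℤ) • h1 + (-1 : ℤ) ^ (m * n) • h2 - ((-1 : ℤ) ^ (m * p) * (-1) ^ (n * p)) • h3
  rcases a with a | a <;> rcases b with b | b <;> rcases c with c | c <;> rw [a, b, c] <;> module

/-- An odd element that squares to zero acts by a differential. -/
theorem gerstenhaberBracket_sq_zero (hx : x ∈ cochainGrading K V V m) (hm : Odd m)
    (hy : y ∈ cochainGrading K V V n) (h : cochainsComp K V x x = 0) :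
    gerstenhaberBracket K V x (gerstenhaberBracket K V x y) = 0 := by
  -- The Jacobi identity would lose a factor `2` here, so the compositions are expanded directly and
  -- `(y ∘ x) ∘ x = y ∘ (x ∘ x) = 0` is used.
  have h1 := cochainsComp_preLie hx hx hy
  have h2 := cochainsComp_sq_of_odd hy hx hm
  have e : (-1 : ℤ) ^ (m * m) = -1 := (hm.mul hm).neg_one_pow
  rw [h, map_zero] at h2
  rw [h, map_zero, LinearMap.zero_apply] at h1
  rw [gerstenhaberBracket_eq hx (gerstenhaberBracket_mem hx hy), gerstenhaberBracket_eq hx hy]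
  simp only [map_sub, map_zsmul, LinearMap.sub_apply, LinearMap.smul_apply, mul_add, pow_add, h2, e]
  linear_combination (norm := skip) (-1 : ℤ) • h1
  rcases neg_one_pow_eq_or ℤ (m * n) with a | a <;> rw [a] <;> module

end Composition

/-! ### Lifted cochains form an abelian subalgebra -/

section Lift

variable {K : Type*} [Field K] {A A' : Type*} [AddCommGroup A] [Module K A]
  [AddCommGroup A'] [Module K A']

/-- The lift `((x_1, u_1), …) ↦ (0, f(x_1, …))` of a cochain. -/
def liftCochain {n : ℕ} (f : Cochain K A A' n) : Cochain K (A × A') (A × A') n :=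
  (LinearMap.inr K A A').compMultilinearMap (f.compLinearMap fun _ => LinearMap.fst K A A')

theorem cochainLift_lof {n : ℕ} (f : Cochain K A A' n) :
    cochainLift K A A' (DirectSum.lof K ℕ (Cochain K A A') n f)
      = DirectSum.lof K ℕ (Cochain K (A × A') (A × A')) n (liftCochain f) := by
  rw [cochainLift, DirectSum.lmap_lof]
  rfl

theorem evalSeq_liftCochain {n : ℕ} (f : Cochain K A A' n) (s : ℕ → A × A') :
    evalSeq (liftCochain f) s = (0, evalSeq f fun k => (s k).1) := rfl

theorem componentEval_cochainLift (x : Cochains K A A') (N : ℕ) (s : ℕ → A × A') :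
    componentEval N s (cochainLift K A A' x) = (0, componentEval N (fun k => (s k).1) x) := by
  change evalSeq (cochainLift K A A' x N) s = _
  rw [cochainLift, DirectSum.lmap_apply]
  rfl

theorem componentEval_cochainProj (x : Cochains K (A × A') (A × A')) (N : ℕ) (s : ℕ → A) :
    componentEval N s (cochainProj K A A' x) = (componentEval N (fun k => (s k, 0)) x).2 := by
  change evalSeq (cochainProj K A A' x N) s = _
  rw [cochainProj, DirectSum.lmap_apply]
  rfl

theorem cochainProj_cochainLift (x : Cochains K A A') :
    cochainProj K A A' (cochainLift K A A' x) = x :=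
  cochains_ext fun N s => by rw [componentEval_cochainProj, componentEval_cochainLift]

theorem cochainLift_mem {d : ℤ} {x : Cochains K A A'} (hx : x ∈ cochainGrading K A A' d) :
    cochainLift K A A' x ∈ cochainGrading K (A × A') (A × A') d := fun n hn =>
  evalSeq_ext fun s => (componentEval_cochainLift x n s).trans
    (congrArg (fun f => ((0 : A), evalSeq f fun k => (s k).1)) (hx n hn))

theorem cochainProj_mem {d : ℤ} {x : Cochains K (A × A') (A × A')}
    (hx : x ∈ cochainGrading K (A × A') (A × A') d) :
    cochainProj K A A' x ∈ cochainGrading K A A' d := fun n hn =>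
  evalSeq_ext fun s => (componentEval_cochainProj x n s).trans
    (congrArg (fun f => (evalSeq f fun k => (s k, (0 : A'))).2) (hx n hn))

theorem fst_insertSeq {X Y : Type*} (i n : ℕ) (v : X × Y) (s : ℕ → X × Y) :
    (fun k => (insertSeq i n v s k).1) = insertSeq i n v.1 (fun k => (s k).1) := by
  funext k
  simp only [insertSeq]
  split_ifs <;> rfl

theorem evalSeq_gerstenhaberComp_liftCochain {m n : ℕ} (f : Cochain K A A' m)
    (g : Cochain K (A × A') (A × A') n) (s : ℕ → A × A') :
    evalSeq (gerstenhaberComp m n (liftCochain f) g) s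
      = (0, ∑ i ∈ Finset.range (m + 1), ((-1 : ℤ) ^ (i * n)) •
          evalSeq f (insertSeq i n (evalSeq g fun k => s (i + k)).1 fun k => (s k).1)) := by
  rw [evalSeq_gerstenhaberComp]
  simp only [evalSeq_liftCochain, fst_insertSeq]
  ext
  · simp [Prod.fst_sum]
  · simp [Prod.snd_sum]

/-- A lift sees only the first component of the inserted value; when that is zero, multilinearity
kills every term. -/
theorem gerstenhaberComp_liftCochain_eq_zero {m n : ℕ} (f : Cochain K A A' m)
    {g : Cochain K (A × A') (A × A') n} (hg : ∀ s, (evalSeq g s).1 = 0) :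
    gerstenhaberComp m n (liftCochain f) g = 0 := by
  refine evalSeq_ext fun s => ?_
  rw [evalSeq_gerstenhaberComp_liftCochain, Finset.sum_eq_zero]
  · rfl
  · intro i hi
    rw [hg, evalSeq_insertSeq_zero (Finset.mem_range.1 hi), smul_zero]

theorem gerstenhaberBracket_cochainLift (x y : Cochains K A A') :
    gerstenhaberBracket K (A × A') (cochainLift K A A' x) (cochainLift K A A' y) = 0 := by
  induction x using DirectSum.induction_on with
  | zero => simp
  | add x x' hx hx' => rw [map_add, map_add, LinearMap.add_apply, hx, hx', add_zero]
  | of m f =>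
    induction y using DirectSum.induction_on with
    | zero => simp
    | add y y' hy hy' => rw [map_add, map_add, hy, hy', add_zero]
    | of n g =>
      rw [← DirectSum.lof_eq_of K, ← DirectSum.lof_eq_of K, cochainLift_lof, cochainLift_lof,
        gerstenhaberBracket_eq (lof_mem_cochainGrading rfl _) (lof_mem_cochainGrading rfl _),
        cochainsComp_lof, cochainsComp_lof,
        gerstenhaberComp_liftCochain_eq_zero _ fun s => rfl,
        gerstenhaberComp_liftCochain_eq_zero _ fun s => rfl]
      simp

end Lift

/-! ### The multiplication of `A ⊕_M A` -/

section SumM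

variable {K : Type*} [Field K] {A : Type*} [NonUnitalRing A] [Module K A]
  [IsScalarTower K A A] [SMulCommClass K A A]

variable (K A) in
/-- The multiplication of `A` as a binary cochain. -/
def mulCochain : Cochain K A A 1 :=
  MultilinearMap.mk' (fun x => x 0 * x 1)
    (fun x p v w => by fin_cases p <;> simp [add_mul, mul_add])
    (fun x p c v => by fin_cases p <;> simp [smul_mul_assoc, mul_smul_comm])

theorem evalSeq_mulCochain (s : ℕ → A) : evalSeq (mulCochain K A) s = s 0 * s 1 := rfl

/-- The multiplication of a quasi-twilled algebra as a binary cochain. -/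
def QuasiTwilledAlgebra.mulCochain {A A' : Type*} [AddCommGroup A] [Module K A]
    [AddCommGroup A'] [Module K A'] (Q : QuasiTwilledAlgebra K A A') :
    Cochain K (A × A') (A × A') 1 :=
  MultilinearMap.mk' (fun x => Q.mul (x 0) (x 1))
    (fun x p v w => by fin_cases p <;> simp)
    (fun x p c v => by fin_cases p <;> simp)

theorem evalSeq_sumM_mulCochain (lam : K) (s : ℕ → A × A) :
    evalSeq (sumM A lam).mulCochain s
      = ((s 0).1 * (s 1).2 + (s 0).2 * (s 1).1,
        lam • ((s 0).1 * (s 1).1) + (s 0).2 * (s 1).2) := rfl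

theorem delta_eq_lof (lam : K) : (sumM A lam).delta
    = DirectSum.lof K ℕ (Cochain K (A × A) (A × A)) 1 (sumM A lam).mulCochain := rfl

/-- The weight enters only through an element of the abelian subalgebra of lifts, so bracketing with
any lift removes it. -/
theorem delta_sumM (lam : K) : (sumM A lam).delta
    = (sumM A (0 : K)).delta
      + lam • cochainLift K A A (DirectSum.lof K ℕ (Cochain K A A) 1 (mulCochain K A)) := by
  refine cochains_ext fun N s => ?_
  rw [map_add, map_smul, componentEval_cochainLift]
  simp only [delta_eq_lof, componentEval_lof]
  split_ifs
  · simp only [evalSeq_sumM_mulCochain, evalSeq_mulCochain]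
    ext <;> simp [add_comm]
  · ext <;> simp

theorem cochainsComp_delta_self (lam : K) :
    cochainsComp K (A × A) (sumM A lam).delta (sumM A lam).delta = 0 := by
  rw [delta_eq_lof, cochainsComp_lof]
  refine (congrArg _ ?_).trans (map_zero _)
  refine evalSeq_ext fun s => ?_
  simp only [evalSeq_gerstenhaberComp, Finset.sum_range_succ, Finset.sum_range_zero]
  have := (sumM A lam).mul_assoc (s 0) (s 1) (s 2)
  change _ = (0 : A × A)
  simp only [evalSeq, insertSeq, QuasiTwilledAlgebra.mulCochain]
  simp
  rw [this]; simp

/-- This is the part of the associativity of `Ω` that is linear in `λ`. It makes the curvature `λ μ`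
invisible to the binary bracket. -/
theorem gerstenhaberBracket_delta_mulCochain :
    gerstenhaberBracket K (A × A) (sumM A (0 : K)).delta
      (cochainLift K A A (DirectSum.lof K ℕ (Cochain K A A) 1 (mulCochain K A))) = 0 := by
  rw [delta_eq_lof, cochainLift_lof,
    gerstenhaberBracket_eq (lof_mem_cochainGrading rfl _) (lof_mem_cochainGrading rfl _),
    cochainsComp_lof, cochainsComp_lof, ← map_zsmul, ← map_sub]
  refine (congrArg _ ?_).trans (map_zero _)
  refine evalSeq_ext fun s => ?_
  change evalSeq (gerstenhaberComp 1 1 _ _) s - ((-1 : ℤ) ^ (1 * 1)) •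
    evalSeq (gerstenhaberComp 1 1 _ _) s = 0
  simp only [evalSeq_gerstenhaberComp, Finset.sum_range_succ, Finset.sum_range_zero,
    evalSeq_sumM_mulCochain, evalSeq_liftCochain, evalSeq_mulCochain]
  ext <;> simp [insertSeq, mul_assoc, add_mul, mul_add]
  abel

/-- Of the four terms of the expansion, `g ∘ (f ∘ Ω₀)` vanishes because `f ∘ Ω₀` takes values in the
second summand. The pre-Lie identity turns `(f ∘ Ω₀) ∘ g` into `f ∘ (Ω₀ ∘ g)`, since the remaining
compositions of lifts are zero. -/
theorem gerstenhaberBracket_delta_eq {p q : ℕ} (f : Cochain K A A p) (g : Cochain K A A q) :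
    gerstenhaberBracket K (A × A) (gerstenhaberBracket K (A × A) (sumM A (0 : K)).delta
        (DirectSum.lof K ℕ (Cochain K (A × A) (A × A)) p (liftCochain f)))
        (DirectSum.lof K ℕ (Cochain K (A × A) (A × A)) q (liftCochain g))
      = DirectSum.lof K ℕ (Cochain K (A × A) (A × A)) (1 + p + q)
          (gerstenhaberComp (1 + p) q (gerstenhaberComp 1 p (sumM A (0 : K)).mulCochain
            (liftCochain f)) (liftCochain g))
        - (-1 : ℤ) ^ p • DirectSum.lof K ℕ (Cochain K (A × A) (A × A)) (p + (1 + q))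
          (gerstenhaberComp p (1 + q) (liftCochain f)
            (gerstenhaberComp 1 q (sumM A (0 : K)).mulCochain (liftCochain g)))
        - (-1 : ℤ) ^ ((1 + p) * q) • DirectSum.lof K ℕ (Cochain K (A × A) (A × A)) (q + (1 + p))
          (gerstenhaberComp q (1 + p) (liftCochain g)
            (gerstenhaberComp 1 p (sumM A (0 : K)).mulCochain (liftCochain f))) := by
  have hO : (sumM A (0 : K)).delta ∈ cochainGrading K (A × A) (A × A) (1 : ℕ) :=
    lof_mem_cochainGrading rfl _
  have hf := lof_mem_cochainGrading (n := p) rfl (liftCochain f)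
  have hg := lof_mem_cochainGrading (n := q) rfl (liftCochain g)
  have h1 := cochainsComp_preLie hf hO hg
  rw [gerstenhaberBracket_eq (gerstenhaberBracket_mem hO hf) hg, gerstenhaberBracket_eq hO hf]
  simp only [map_sub, map_zsmul, LinearMap.sub_apply, LinearMap.smul_apply]
  simp only [delta_eq_lof, cochainsComp_lof] at h1 ⊢
  have e1 : gerstenhaberComp p q (liftCochain f) (liftCochain g) = 0 :=
    gerstenhaberComp_liftCochain_eq_zero _ fun s => rfl
  have e2 : gerstenhaberComp q (p + 1) (liftCochain g)
      (gerstenhaberComp p 1 (liftCochain f) (sumM A (0 : K)).mulCochain) = 0 :=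
    gerstenhaberComp_liftCochain_eq_zero _ fun s => by
      rw [evalSeq_gerstenhaberComp_liftCochain]
  have e3 : gerstenhaberComp p (q + 1) (liftCochain f)
      (gerstenhaberComp q 1 (liftCochain g) (sumM A (0 : K)).mulCochain) = 0 :=
    gerstenhaberComp_liftCochain_eq_zero _ fun s => by
      rw [evalSeq_gerstenhaberComp_liftCochain]
  rw [e1, e3] at h1
  simp only [map_zero, LinearMap.zero_apply, sub_zero, smul_zero, sub_eq_zero] at h1
  rw [e2, h1]
  simp

end SumM

/-! ### The explicit formula for the binary bracket -/

section ExplicitFormula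

variable {K : Type*} [Field K] {A : Type*} [NonUnitalRing A] [Module K A]

theorem apply_window {n : ℕ} (f : Cochain K A A n) (x : ℕ → A) (a : ℕ) :
    f (window x a (n + 1)) = evalSeq f fun k => x (a + k) := rfl

theorem apply_replaceBlock {n : ℕ} (f : Cochain K A A n) (x : ℕ → A) (i r : ℕ) (a : A) :
    f (replaceBlock x (i + 1) a r (n + 1)) = evalSeq f (insertSeq i r a fun k => x (1 + k)) := by
  refine congrArg f (funext fun k => ?_)
  simp only [replaceBlock, insertSeq]
  split_ifs <;> first | rfl | (exfalso; omega) | (congr 1; omega)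

theorem sum_Icc_one {M : Type*} [AddCommMonoid M] (m : ℕ) (F : ℕ → M) :
    ∑ i ∈ Finset.Icc 1 m, F i = ∑ i ∈ Finset.range m, F (i + 1) := by
  rw [Finset.range_eq_Ico, Finset.sum_Ico_add' F 0 m 1]
  rfl

variable [IsScalarTower K A A] [SMulCommClass K A A]

theorem fst_evalSeq_gerstenhaberComp_sumM {p : ℕ} (f : Cochain K A A p) (s : ℕ → A × A) :
    (evalSeq (gerstenhaberComp 1 p (sumM A (0 : K)).mulCochain (liftCochain f)) s).1
      = evalSeq f (fun k => (s k).1) * (s (p + 1)).1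
        + (-1 : ℤ) ^ p • ((s 0).1 * evalSeq f fun k => (s (1 + k)).1) := by
  rw [evalSeq_gerstenhaberComp]
  simp [Finset.sum_range_succ, evalSeq_sumM_mulCochain, evalSeq_liftCochain, insertSeq, add_comm 1 p]

theorem disjointInsertions_sumM {p q : ℕ} (f : Cochain K A A p) (g : Cochain K A A q)
    (s : ℕ → A × A) :
    disjointInsertions (sumM A (0 : K)).mulCochain (liftCochain f) (liftCochain g) s
      = (0, (-1 : ℤ) ^ p • (evalSeq g (fun k => (s k).1)
          * evalSeq f fun k => (s (1 + q + k)).1)) := by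
  simp [disjointInsertions, Finset.sum_range_succ, evalSeq_sumM_mulCochain, evalSeq_liftCochain,
    insertSeq]

/-- The two products come from the disjoint insertions of `f` and `g` into `Ω₀`; the four sums come
from `f ∘ (Ω₀ ∘ g)` and `g ∘ (Ω₀ ∘ f)`. The second components of `s` are left free, which shows that
the double bracket is itself a lift. -/
theorem componentEval_gerstenhaberBracket_delta {p q : ℕ} (f : Cochain K A A p)
    (g : Cochain K A A q) (N : ℕ) (s : ℕ → A × A) (x : ℕ → A) (hx : ∀ k, (s k).1 = x (1 + k)) :
    componentEval N s (gerstenhaberBracket K (A × A)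
        (gerstenhaberBracket K (A × A) (sumM A (0 : K)).delta
          (DirectSum.lof K ℕ (Cochain K (A × A) (A × A)) p (liftCochain f)))
        (DirectSum.lof K ℕ (Cochain K (A × A) (A × A)) q (liftCochain g)))
      = if p + q + 1 = N then (0, explicitL2 f g x) else 0 := by
  rw [gerstenhaberBracket_delta_eq, map_sub, map_sub, map_zsmul, map_zsmul,
    componentEval_lof, componentEval_lof, componentEval_lof]
  by_cases h : p + q + 1 = N
  · rw [if_pos (by omega), if_pos (by omega), if_pos (by omega), if_pos h,
      evalSeq_gerstenhaberComp_assoc, gerstenhaberComp_liftCochain_eq_zero f (fun _ => rfl),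
      map_zero, disjointInsertions_sumM, disjointInsertions_sumM,
      evalSeq_gerstenhaberComp_liftCochain, evalSeq_gerstenhaberComp_liftCochain]
    simp only [fst_evalSeq_gerstenhaberComp_sumM, hx]
    ext
    · simp [evalSeq]
    · simp only [explicitL2, apply_window, sum_Icc_one, apply_replaceBlock]
      -- The first component of `Ω₀ ∘ h` has two summands, so each insertion sum splits in two.
      have key : ∀ {m n : ℕ} (h : Cochain K A A m) (U U' : ℕ → A) (X : ℕ → A),
          ∑ i ∈ Finset.range (m + 1), (-1 : ℤ) ^ (i * (1 + n)) •
              evalSeq h (insertSeq i (1 + n) (U i + (-1 : ℤ) ^ n • U' i) X)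
            = ∑ i ∈ Finset.range (m + 1), (-1 : ℤ) ^ (i * (n + 1)) •
                evalSeq h (insertSeq i (n + 1) (U i) X)
              + (-1 : ℤ) ^ n • ∑ i ∈ Finset.range (m + 1), (-1 : ℤ) ^ (i * (n + 1)) •
                evalSeq h (insertSeq i (n + 1) (U' i) X) := by
        intro m n h U U' X
        rw [Finset.smul_sum, ← Finset.sum_add_distrib]
        refine Finset.sum_congr rfl fun i hi => ?_
        rw [Finset.mem_range] at hi
        rw [add_comm 1 n, evalSeq_insertSeq_add hi, evalSeq_insertSeq_zsmul hi, smul_add,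
          smul_comm ((-1 : ℤ) ^ n)]
      have factor : ∀ (m n : ℕ) (c : ℤ) (G : ℕ → A),
          ∑ i ∈ Finset.range (m + 1), ((-1 : ℤ) ^ (i * n) * c) • G i
            = c • ∑ i ∈ Finset.range (m + 1), (-1 : ℤ) ^ (i * n) • G i := by
        intro m n c G
        rw [Finset.smul_sum]
        exact Finset.sum_congr rfl fun i _ => by rw [smul_smul, mul_comm]
      have shift : ∀ (i n : ℕ) (c : ℤ),
          (-1 : ℤ) ^ ((i + 1) * n) * c = (-1) ^ (i * n) * ((-1) ^ n * c) := by
        intro i n c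
        ring
      simp only [Prod.snd_add, Prod.snd_sub, Prod.smul_snd, key, shift, Nat.add_sub_cancel, factor]
      have e0 : evalSeq (0 : Cochain K (A × A) (A × A) (1 + (p + q))) s = 0 := rfl
      rw [e0]
      simp only [Nat.add_assoc, Nat.add_comm, Nat.add_left_comm, Nat.add_zero, Prod.snd_zero,
        zero_add]
      -- Every remaining sign is a product of powers of `(-1)^p`, `(-1)^q` and `(-1)^(p q)`, which
      -- leaves eight cases.
      have sp := neg_one_pow_eq_or ℤ p
      have sq := neg_one_pow_eq_or ℤ q
      have spq := neg_one_pow_eq_or ℤ (p * q)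
      simp only [Nat.mul_add, Nat.add_mul, pow_add, Nat.mul_one, Nat.one_mul, pow_one]
      rcases sp with sp | sp <;> rcases sq with sq | sq <;> rcases spq with spq | spq <;>
        rw [sp, sq, spq] <;> module
  · rw [if_neg (by omega), if_neg (by omega), if_neg (by omega), if_neg h]
    simp

end ExplicitFormula

/-! ### Symmetry and Jacobi identity of the binary bracket -/

section BinaryBracket

variable {K : Type*} [Field K] {A : Type*} [NonUnitalRing A] [Module K A]
  [IsScalarTower K A A] [SMulCommClass K A A]

variable (K A) in
/-- The binary derived bracket `P [[Ω, f]_G, g]_G`, computed with the weight `0` multiplication. -/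
noncomputable def binaryBracket : Cochains K A A →ₗ[K] Cochains K A A →ₗ[K] Cochains K A A :=
  ((gerstenhaberBracket K (A × A) ∘ₗ gerstenhaberBracket K (A × A) (sumM A (0 : K)).delta ∘ₗ
    cochainLift K A A).compl₂ (cochainLift K A A)).compr₂ (cochainProj K A A)

theorem binaryBracket_apply (x y : Cochains K A A) :
    binaryBracket K A x y = cochainProj K A A (gerstenhaberBracket K (A × A)
      (gerstenhaberBracket K (A × A) (sumM A (0 : K)).delta (cochainLift K A A x))
      (cochainLift K A A y)) := rfl

theorem componentEval_binaryBracket {p q : ℕ} (f : Cochain K A A p) (g : Cochain K A A q)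
    (N : ℕ) (x : ℕ → A) :
    componentEval N (fun k => x (1 + k)) (binaryBracket K A
        (DirectSum.lof K ℕ (Cochain K A A) p f) (DirectSum.lof K ℕ (Cochain K A A) q g))
      = if p + q + 1 = N then explicitL2 f g x else 0 := by
  rw [binaryBracket_apply, componentEval_cochainProj, cochainLift_lof, cochainLift_lof,
    componentEval_gerstenhaberBracket_delta f g N _ x fun k => rfl]
  split_ifs <;> rfl

/-- The projection loses nothing on double brackets. Nested binary brackets can therefore be
computed inside the Gerstenhaber Lie algebra, and triple brackets vanish. -/
theorem cochainLift_binaryBracket (x y : Cochains K A A) :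
    cochainLift K A A (binaryBracket K A x y) = gerstenhaberBracket K (A × A)
      (gerstenhaberBracket K (A × A) (sumM A (0 : K)).delta (cochainLift K A A x))
      (cochainLift K A A y) := by
  induction x using DirectSum.induction_on with
  | zero => simp
  | add x x' hx hx' => simp only [map_add, LinearMap.add_apply, hx, hx']
  | of p f =>
    induction y using DirectSum.induction_on with
    | zero => simp
    | add y y' hy hy' => simp only [map_add, hy, hy']
    | of q g =>
      refine cochains_ext fun N s => ?_
      -- The explicit formula numbers its arguments from `1`, hence the shift; the value at `0` is
      -- irrelevant.
      obtain ⟨x, hs⟩ : ∃ x : ℕ → A, (fun k => (s k).1) = fun k => x (1 + k) :=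
        ⟨fun k => (s (k - 1)).1, by simp⟩
      rw [← DirectSum.lof_eq_of K, ← DirectSum.lof_eq_of K, componentEval_cochainLift, hs,
        componentEval_binaryBracket, cochainLift_lof, cochainLift_lof,
        componentEval_gerstenhaberBracket_delta f g N s _ (congrFun hs)]
      split_ifs <;> rfl

theorem delta_mem (lam : K) :
    (sumM A lam).delta ∈ cochainGrading K (A × A) (A × A) (1 : ℕ) :=
  lof_mem_cochainGrading rfl _

variable {m n p : ℕ} {x y z : Cochains K A A}

theorem binaryBracket_mem (hx : x ∈ cochainGrading K A A m) (hy : y ∈ cochainGrading K A A n) :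
    binaryBracket K A x y ∈ cochainGrading K A A (1 + m + n : ℕ) :=
  cochainProj_mem (gerstenhaberBracket_mem
    (gerstenhaberBracket_mem (delta_mem 0) (cochainLift_mem hx)) (cochainLift_mem hy))

/-- Since the lifts of `x` and `y` commute, the Jacobi identity for `Ω₀, x, y` has zero left side
and equates the two double brackets up to sign. -/
theorem binaryBracket_symm (hx : x ∈ cochainGrading K A A m) (hy : y ∈ cochainGrading K A A n) :
    binaryBracket K A x y = (-1 : ℤ) ^ (m * n) • binaryBracket K A y x := by
  have h := gerstenhaberBracket_jacobi (delta_mem (0 : K)) (cochainLift_mem hx)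
    (cochainLift_mem hy)
  rw [gerstenhaberBracket_cochainLift, map_zero] at h
  rw [binaryBracket_apply, binaryBracket_apply, ← map_zsmul, ← sub_eq_zero, ← map_sub, ← h,
    map_zero]

/-- The graded Jacobi identity of the binary derived bracket. -/
theorem binaryBracket_jacobi (hx : x ∈ cochainGrading K A A m)
    (hy : y ∈ cochainGrading K A A n) (hz : z ∈ cochainGrading K A A p) :
    binaryBracket K A (binaryBracket K A x y) z
      + (-1 : ℤ) ^ (n * p) • binaryBracket K A (binaryBracket K A x z) y
      + (-1 : ℤ) ^ (m * (n + p)) • binaryBracket K A (binaryBracket K A y z) x = 0 := by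
  have hO := delta_mem (A := A) (0 : K)
  have hx' := gerstenhaberBracket_mem hO (cochainLift_mem hx)
  have hy' := gerstenhaberBracket_mem hO (cochainLift_mem hy)
  have hz' := cochainLift_mem hz
  -- With `d = [Ω₀, ·]`, the Jacobi identity and `d² = 0` leave only the bracket of `d y` and `d x`
  -- in `d [d x, y]`.
  have h1 : gerstenhaberBracket K (A × A) (sumM A (0 : K)).delta
        (cochainLift K A A (binaryBracket K A x y))
      = -((-1 : ℤ) ^ ((1 + m) * n) • gerstenhaberBracket K (A × A)
        (gerstenhaberBracket K (A × A) (sumM A (0 : K)).delta (cochainLift K A A y))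
        (gerstenhaberBracket K (A × A) (sumM A (0 : K)).delta (cochainLift K A A x))) := by
    rw [cochainLift_binaryBracket, gerstenhaberBracket_jacobi hO hx' (cochainLift_mem hy),
      gerstenhaberBracket_sq_zero hO odd_one (cochainLift_mem hx) (cochainsComp_delta_self 0)]
    simp
  -- The Jacobi identity for `d y, d x, z` contains all three nested brackets; antisymmetry and the
  -- symmetry of the binary bracket bring them to the required order.
  have h2 := gerstenhaberBracket_jacobi hy' hx' hz'
  have h3 := gerstenhaberBracket_antisymm (gerstenhaberBracket_mem hy' hz') hx'
  rw [← cochainLift_binaryBracket] at h2 h3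
  have h4 := congrArg (cochainProj K A A) h2
  have h5 := congrArg (cochainProj K A A) h3
  rw [map_sub, map_zsmul, ← cochainLift_binaryBracket y z, h5] at h4
  rw [map_zsmul, ← binaryBracket_apply, ← binaryBracket_apply,
    binaryBracket_symm hy (binaryBracket_mem hx hz),
    binaryBracket_symm hx (binaryBracket_mem hy hz)] at h4
  rw [binaryBracket_apply (binaryBracket K A x y), h1, map_neg, map_zsmul, LinearMap.neg_apply,
    LinearMap.smul_apply, map_neg, map_zsmul]
  simp only [mul_add, add_mul, pow_add, mul_one, one_mul, pow_one, mul_comm n m, mul_comm p m] at h4 ⊢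
  have sq : ∀ k : ℕ, (-1 : ℤ) ^ k * (-1) ^ k = 1 := fun k => by
    rw [← mul_pow, neg_one_mul, neg_neg, one_pow]
  have a := sq m
  have b := sq n
  have c := sq p
  have ab := sq (m * n)
  have ac := sq (m * p)
  rw [eq_comm, sub_eq_iff_eq_add] at h4
  rw [h4]
  clear h1 h2 h3 h4 h5 sq
  generalize (-1 : ℤ) ^ m = a, (-1 : ℤ) ^ n = b, (-1 : ℤ) ^ p = c, (-1 : ℤ) ^ (m * n) = ab,
    (-1 : ℤ) ^ (m * p) = ac, (-1 : ℤ) ^ (n * p) = bc at *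
  match_scalars <;> grind

theorem binaryBracket_mulCochain_left :
    binaryBracket K A (DirectSum.lof K ℕ (Cochain K A A) 1 (mulCochain K A)) x = 0 := by
  rw [binaryBracket_apply, gerstenhaberBracket_delta_mulCochain, map_zero, LinearMap.zero_apply,
    map_zero]

end BinaryBracket

/-! ### Computation of all derived brackets -/

section DerivedBracket

variable {K : Type*} [Field K] {A : Type*} [NonUnitalRing A] [Module K A]
  [IsScalarTower K A A] [SMulCommClass K A A] (lam : K)

theorem iteratedBracket_succ (k : ℕ) (x : Fin (k + 1) → Cochains K A A) :
    (sumM A lam).iteratedBracket (k + 1) x = gerstenhaberBracket K (A × A)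
      ((sumM A lam).iteratedBracket k (Fin.init x)) (cochainLift K A A (x (Fin.last k))) := rfl

theorem iteratedBracket_one (x : Fin 1 → Cochains K A A) :
    (sumM A lam).iteratedBracket 1 x = gerstenhaberBracket K (A × A)
      (sumM A (0 : K)).delta (cochainLift K A A (x 0)) := by
  rw [iteratedBracket_succ]
  change gerstenhaberBracket K (A × A) (sumM A lam).delta _ = _
  rw [delta_sumM, map_add, LinearMap.add_apply, map_smul, LinearMap.smul_apply,
    gerstenhaberBracket_cochainLift, smul_zero, add_zero]
  rfl

theorem iteratedBracket_two (x : Fin 2 → Cochains K A A) :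
    (sumM A lam).iteratedBracket 2 x = cochainLift K A A (binaryBracket K A (x 0) (x 1)) := by
  rw [iteratedBracket_succ, iteratedBracket_one, cochainLift_binaryBracket]
  rfl

theorem iteratedBracket_add_three (k : ℕ) : (sumM A lam).iteratedBracket (k + 3) = 0 := by
  induction k with
  | zero =>
    refine MultilinearMap.ext fun x => ?_
    rw [iteratedBracket_succ, iteratedBracket_two, gerstenhaberBracket_cochainLift]
    rfl
  | succ k ih =>
    refine MultilinearMap.ext fun x => ?_
    rw [iteratedBracket_succ, ih, zero_apply, map_zero]
    rfl

theorem derivedBracket_zero (x : Fin 0 → Cochains K A A) :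
    (sumM A lam).derivedBracket 0 x
      = lam • DirectSum.lof K ℕ (Cochain K A A) 1 (mulCochain K A) := by
  change cochainProj K A A (sumM A lam).delta = _
  rw [delta_sumM, map_add, map_smul, cochainProj_cochainLift, add_eq_right]
  refine cochains_ext fun N s => ?_
  rw [componentEval_cochainProj, delta_eq_lof, componentEval_lof]
  split_ifs <;> simp [evalSeq_sumM_mulCochain]

/-- On arguments from the first summand, `Ω₀` vanishes, which removes `f ∘ Ω₀`. In `Ω₀ ∘ f` one
factor lies in each summand, so the value lies in the first summand and is projected away. -/
theorem derivedBracket_one : (sumM A lam).derivedBracket 1 = 0 := by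
  refine MultilinearMap.ext fun x => ?_
  change cochainProj K A A ((sumM A lam).iteratedBracket 1 x) = 0
  rw [iteratedBracket_one]
  induction x 0 using DirectSum.induction_on with
  | zero => simp
  | add y z hy hz => rw [map_add, map_add, map_add, hy, hz, add_zero]
  | of n f =>
    rw [← DirectSum.lof_eq_of K, cochainLift_lof,
      gerstenhaberBracket_eq (delta_mem 0) (lof_mem_cochainGrading rfl _), delta_eq_lof,
      cochainsComp_lof, cochainsComp_lof]
    refine cochains_ext fun N s => ?_
    rw [componentEval_cochainProj, map_sub, map_zsmul, componentEval_lof, componentEval_lof,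
      evalSeq_gerstenhaberComp_liftCochain, Finset.sum_eq_zero]
    · rw [evalSeq_gerstenhaberComp]
      split_ifs <;>
        simp [Finset.sum_range_succ, evalSeq_sumM_mulCochain, evalSeq_liftCochain, insertSeq]
    · intro i hi
      rw [evalSeq_sumM_mulCochain]
      simp [evalSeq_insertSeq_zero (Finset.mem_range.1 hi)]

theorem derivedBracket_two (x : Fin 2 → Cochains K A A) :
    (sumM A lam).derivedBracket 2 x = binaryBracket K A (x 0) (x 1) := by
  change cochainProj K A A ((sumM A lam).iteratedBracket 2 x) = _
  rw [iteratedBracket_two, cochainProj_cochainLift]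

theorem derivedBracket_add_three (k : ℕ) : (sumM A lam).derivedBracket (k + 3) = 0 := by
  refine MultilinearMap.ext fun x => ?_
  change cochainProj K A A ((sumM A lam).iteratedBracket (k + 3) x) = 0
  rw [iteratedBracket_add_three, zero_apply, map_zero]

theorem derivedBracket_eq_zero {k : ℕ} (h0 : k ≠ 0) (h2 : k ≠ 2) :
    (sumM A lam).derivedBracket k = 0 := by
  match k with
  | 1 => exact derivedBracket_one lam
  | k + 3 => exact derivedBracket_add_three lam k

end DerivedBracket

/-! ### The curved `L_∞` axioms -/

section CurvedLInfty

theorem negOnePow_natCast_mul (m n : ℕ) :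
    (((m : ℤ) * n).negOnePow : ℤ) = (-1) ^ (m * n) := by
  rw [← Nat.cast_mul, Int.negOnePow_def, zpow_natCast]
  simp

theorem koszulSign_one {n : ℕ} (d : Fin n → ℤ) : koszulSign d 1 = 1 := by
  rw [koszulSign, Finset.filter_false_of_mem, Finset.prod_empty]
  intro p _ h
  exact lt_asymm h.1 h.2

theorem koszulSign_eq {n : ℕ} (d : Fin n → ℤ) (σ : Equiv.Perm (Fin n))
    (S : Finset (Fin n × Fin n))
    (hS : Finset.univ.filter (fun p : Fin n × Fin n => p.1 < p.2 ∧ σ p.2 < σ p.1) = S) :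
    koszulSign d σ = ∏ p ∈ S, ((d (σ p.1) * d (σ p.2)).negOnePow : ℤ) := by
  rw [koszulSign, hS]

theorem shuffles_three_two : shuffles 3 2
    = {1, Equiv.swap 1 2, finRotate 3} := by
  decide

theorem shuffles_one_zero : shuffles 1 0 = {1} := by
  decide

variable {K : Type*} [Field K] {A : Type*} [NonUnitalRing A] [Module K A]

/-- Reduces the identities for integer degrees to natural degrees: there is nothing nonzero in
negative degree. -/
theorem eq_zero_or_exists_natCast {d : ℤ} {x : Cochains K A A}
    (hx : x ∈ cochainGrading K A A d) : x = 0 ∨ ∃ m : ℕ, d = m := by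
  rcases lt_or_ge d 0 with h | h
  · exact Or.inl (eq_zero_of_mem_cochainGrading h hx)
  · exact Or.inr (Int.eq_ofNat_of_zero_le h)

variable [IsScalarTower K A A] [SMulCommClass K A A]

theorem binaryBracket_mem_int {d e : ℤ} {x y : Cochains K A A}
    (hx : x ∈ cochainGrading K A A d) (hy : y ∈ cochainGrading K A A e) :
    binaryBracket K A x y ∈ cochainGrading K A A (d + e + 1) := by
  rcases eq_zero_or_exists_natCast hx with rfl | ⟨m, rfl⟩
  · simp
  rcases eq_zero_or_exists_natCast hy with rfl | ⟨n, rfl⟩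
  · simp
  convert binaryBracket_mem hx hy using 1
  congr 1
  push_cast
  ring

theorem binaryBracket_symm_int {d e : ℤ} {x y : Cochains K A A}
    (hx : x ∈ cochainGrading K A A d) (hy : y ∈ cochainGrading K A A e) :
    binaryBracket K A x y = ((d * e).negOnePow : ℤ) • binaryBracket K A y x := by
  rcases eq_zero_or_exists_natCast hx with rfl | ⟨m, rfl⟩
  · simp
  rcases eq_zero_or_exists_natCast hy with rfl | ⟨n, rfl⟩
  · simp
  rw [negOnePow_natCast_mul, binaryBracket_symm hx hy]

theorem binaryBracket_jacobi_int {d e r : ℤ} {x y z : Cochains K A A}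
    (hx : x ∈ cochainGrading K A A d) (hy : y ∈ cochainGrading K A A e)
    (hz : z ∈ cochainGrading K A A r) :
    binaryBracket K A (binaryBracket K A x y) z
      + (((r * e).negOnePow : ℤ) • binaryBracket K A (binaryBracket K A x z) y
      + (((e * d).negOnePow : ℤ) * ((r * d).negOnePow : ℤ)) •
        binaryBracket K A (binaryBracket K A y z) x) = 0 := by
  rcases eq_zero_or_exists_natCast hx with rfl | ⟨m, rfl⟩
  · simp
  rcases eq_zero_or_exists_natCast hy with rfl | ⟨n, rfl⟩
  · simp
  rcases eq_zero_or_exists_natCast hz with rfl | ⟨p, rfl⟩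
  · simp
  have := binaryBracket_jacobi hx hy hz
  rwa [negOnePow_natCast_mul, negOnePow_natCast_mul, negOnePow_natCast_mul, ← add_assoc,
    ← pow_add, mul_comm p n, mul_comm n m, mul_comm p m, ← mul_add]

theorem derivedBracket_cons_derivedBracket_eq_zero (lam : K) {n i : ℕ} (u : Fin i → Cochains K A A)
    (v : Fin (n - i) → Cochains K A A) (h : i ≠ 0 ∧ i ≠ 2 ∨ n - i ≠ 1) :
    (sumM A lam).derivedBracket (n - i + 1)
      (Fin.cons (α := fun _ => Cochains K A A) ((sumM A lam).derivedBracket i u) v) = 0 := by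
  rcases h with ⟨h0, h2⟩ | h
  · rw [derivedBracket_eq_zero lam h0 h2]
    exact MultilinearMap.map_coord_zero _ 0 rfl
  · rw [derivedBracket_eq_zero lam (by omega) (by omega)]
    rfl

theorem isCurvedLInfty_sumM (lam : K) :
    IsCurvedLInfty (cochainGrading K A A) (sumM A lam).derivedBracket where
  graded := isInternal_cochainGrading
  degree_one n d x hx := by
    by_cases h0 : n = 0
    · subst h0
      rw [derivedBracket_zero]
      exact Submodule.smul_mem _ _ (lof_mem_cochainGrading (by simp) _)
    by_cases h2 : n = 2
    · subst h2
      rw [derivedBracket_two, Fin.sum_univ_two]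
      exact binaryBracket_mem_int (hx 0) (hx 1)
    rw [derivedBracket_eq_zero lam h0 h2]
    exact zero_mem _
  symm n d x hx σ := by
    by_cases h0 : n = 0
    · subst h0
      rw [Subsingleton.elim σ 1, koszulSign_one, one_smul]
      rfl
    by_cases h2 : n = 2
    · subst h2
      have hσ : σ = 1 ∨ σ = Equiv.swap 0 1 := by
        revert σ
        decide
      rcases hσ with rfl | rfl
      · rw [koszulSign_one, one_smul]
        rfl
      · rw [koszulSign_eq d _ {(0, 1)} (by decide), Finset.prod_singleton, derivedBracket_two,
          derivedBracket_two]
        exact binaryBracket_symm_int (hx 1) (hx 0)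
    simp [derivedBracket_eq_zero lam h0 h2]
  jacobi n d x hx := by
    -- A term survives only if its inner arity `i` is `0` or `2` and its outer arity `n - i + 1` is
    -- `2`, which forces `n = 1` or `n = 3`.
    by_cases h1 : n = 1
    · subst h1
      rw [Fin.sum_univ_two]
      simp only [Fin.coe_ofNat_eq_mod, Nat.zero_mod, shuffles_one_zero, Finset.sum_singleton]
      rw [Finset.sum_eq_zero]
      · rw [add_zero, koszulSign_one, one_smul]
        refine (derivedBracket_two lam _).trans ?_
        change binaryBracket K A ((sumM A lam).derivedBracket 0 _) _ = 0
        rw [derivedBracket_zero, map_smul, LinearMap.smul_apply, binaryBracket_mulCochain_left,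
          smul_zero]
      · intro σ _
        rw [derivedBracket_cons_derivedBracket_eq_zero lam _ _ (by simp), smul_zero]
    by_cases h3 : n = 3
    · subst h3
      rw [Finset.sum_eq_single 2]
      · change ∑ σ ∈ shuffles 3 2, koszulSign d σ • (sumM A lam).derivedBracket 2 _ = 0
        simp only [derivedBracket_two]
        change ∑ σ ∈ shuffles 3 2, koszulSign d σ • binaryBracket K A
          ((sumM A lam).derivedBracket 2 fun a : Fin 2 => x (σ ⟨a, _⟩)) (x (σ 2)) = 0
        simp only [derivedBracket_two]
        -- The three shuffles give the orders `x y z`, `x z y` and `y z x`, with zero, one and two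
        -- inversions.
        rw [shuffles_three_two, Finset.sum_insert (by decide), Finset.sum_insert (by decide),
          Finset.sum_singleton, koszulSign_one, one_smul,
          koszulSign_eq d (Equiv.swap 1 2) {(1, 2)} (by decide), Finset.prod_singleton,
          koszulSign_eq d (finRotate 3) {(0, 2), (1, 2)} (by decide),
          Finset.prod_insert (by decide), Finset.prod_singleton]
        exact binaryBracket_jacobi_int (hx 0) (hx 1) (hx 2)
      · intro i _ hi
        refine Finset.sum_eq_zero fun σ _ => ?_
        have hi' : i.val ≠ 2 := fun h => hi (Fin.ext h)
        rw [derivedBracket_cons_derivedBracket_eq_zero lam _ _ (by omega), smul_zero]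
      · simp
    refine Finset.sum_eq_zero fun i _ => Finset.sum_eq_zero fun σ _ => ?_
    rw [derivedBracket_cons_derivedBracket_eq_zero lam _ _ (by omega), smul_zero]

end CurvedLInfty

/-! ### Maurer-Cartan elements and modified Rota-Baxter operators -/

section MaurerCartan

variable {K : Type*} [Field K] {A : Type*} [NonUnitalRing A] [Module K A]

theorem explicitL2_linearMap (D : A →ₗ[K] A) (x : ℕ → A) :
    explicitL2 (MultilinearMap.ofSubsingleton K A A (0 : Fin 1) D)
      (MultilinearMap.ofSubsingleton K A A (0 : Fin 1) D) x
      = (2 : K) • (D (x 1) * D (x 2) - D (x 1 * D (x 2)) - D (D (x 1) * x 2)) := by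
  simp [explicitL2, window, replaceBlock]
  module

variable [IsScalarTower K A A] [SMulCommClass K A A]

theorem derivedBracket_two_apply_window (lam : K) {p q : ℕ} (f : Cochain K A A p)
    (g : Cochain K A A q) (x : ℕ → A) :
    (sumM A lam).derivedBracket 2
      ![DirectSum.lof K ℕ (Cochain K A A) p f, DirectSum.lof K ℕ (Cochain K A A) q g]
      (p + q + 1) (window x 1 (p + q + 1 + 1)) = explicitL2 f g x := by
  rw [derivedBracket_two]
  exact (componentEval_binaryBracket f g (p + q + 1) x).trans (if_pos rfl)

theorem derivedBracket_zero_apply (lam : K) (x y : A) :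
    (sumM A lam).derivedBracket 0 ![] 1 ![x, y] = lam • (x * y) := by
  rw [derivedBracket_zero, DirectSum.smul_apply, DirectSum.lof_apply]
  rfl

theorem isMaurerCartan_iff (lam : K) (x : Cochains K A A) :
    IsMaurerCartan (cochainGrading K A A) (sumM A lam).derivedBracket x ↔
      x ∈ cochainGrading K A A 0 ∧
        lam • DirectSum.lof K ℕ (Cochain K A A) 1 (mulCochain K A)
          + (2 : K)⁻¹ • binaryBracket K A x x = 0 := by
  -- Index `k` stands for `l_{k+1}`, so the only possible index `1` is that of `l_2`.
  have hs : (Function.support fun k : ℕ => (((k + 1).factorial : K)⁻¹) •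
      (sumM A lam).derivedBracket (k + 1) (fun _ => x)) ⊆ {1} := by
    intro k hk
    by_contra h
    rw [Set.mem_singleton_iff] at h
    refine hk ?_
    change _ • (sumM A lam).derivedBracket (k + 1) _ = 0
    rw [derivedBracket_eq_zero lam (by omega) (by omega), zero_apply, smul_zero]
  rw [IsMaurerCartan, and_iff_right ((Set.finite_singleton 1).subset hs), derivedBracket_zero,
    finsum_eq_single _ 1 fun k hk => by_contra fun h => hk (hs h), derivedBracket_two]
  simp

theorem isMaurerCartan_linearMap_iff (h2 : (2 : K) ≠ 0) (lam : K) (D : A →ₗ[K] A) :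
    IsMaurerCartan (cochainGrading K A A) (sumM A lam).derivedBracket
      (DirectSum.lof K ℕ (Cochain K A A) 0
        (MultilinearMap.ofSubsingleton K A A (0 : Fin 1) D)) ↔ IsModifiedRotaBaxter lam D := by
  have key : ∀ (N : ℕ) (x : ℕ → A), componentEval N (fun k => x (1 + k))
      (lam • DirectSum.lof K ℕ (Cochain K A A) 1 (mulCochain K A)
        + (2 : K)⁻¹ • binaryBracket K A
          (DirectSum.lof K ℕ (Cochain K A A) 0
            (MultilinearMap.ofSubsingleton K A A (0 : Fin 1) D))
          (DirectSum.lof K ℕ (Cochain K A A) 0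
            (MultilinearMap.ofSubsingleton K A A (0 : Fin 1) D)))
      = if 1 = N then lam • (x 1 * x 2)
          + (D (x 1) * D (x 2) - D (x 1 * D (x 2)) - D (D (x 1) * x 2)) else 0 := by
    intro N x
    rw [map_add, map_smul, map_smul, componentEval_lof, componentEval_binaryBracket,
      explicitL2_linearMap, evalSeq_mulCochain, zero_add, zero_add]
    split_ifs
    · rw [inv_smul_smul₀ h2]
    · simp
  rw [isMaurerCartan_iff, and_iff_right (lof_mem_cochainGrading (by simp) _)]
  constructor
  · intro h a b
    have := key 1 fun k => if k = 1 then a else b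
    rw [h, map_zero, if_pos rfl] at this
    exact eq_neg_of_add_eq_zero_right this.symm
  · intro h
    refine cochains_ext fun N s => ?_
    have := key N fun k => s (k - 1)
    simp only [Nat.add_sub_cancel_left] at this
    rw [this, h, add_neg_cancel, ite_self, map_zero]

end MaurerCartan

theorem mainTheorem3 {K : Type*} [Field K] {A : Type*} [NonUnitalRing A] [Module K A]
    [IsScalarTower K A A] [SMulCommClass K A A] (lam : K) :
    -- the derived brackets of `A ⊕_M A` form a curved `L_∞`-algebra
    IsCurvedLInfty (cochainGrading K A A) (sumM A lam).derivedBracket ∧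
    -- `l_0(x, y) = λ x y`
    (∀ x y : A, (sumM A lam).derivedBracket 0 ![] 1 ![x, y] = lam • (x * y)) ∧
    -- `l_1 = 0`
    (sumM A lam).derivedBracket 1 = 0 ∧
    -- the explicit formula for `l_2` on `f ∈ Hom(⊗^{p+1} A, A)` and `g ∈ Hom(⊗^{q+1} A, A)`,
    -- evaluated at `(x_1, …, x_{(p+1)+(q+1)})`
    (∀ (p q : ℕ) (f : Cochain K A A p) (g : Cochain K A A q) (x : ℕ → A),
      (sumM A lam).derivedBracket 2
        ![DirectSum.lof K ℕ (Cochain K A A) p f, DirectSum.lof K ℕ (Cochain K A A) q g]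
        (p + q + 1) (window x 1 (p + q + 1 + 1)) = explicitL2 f g x) ∧
    -- there are no further operations
    (∀ k : ℕ, 3 ≤ k → (sumM A lam).derivedBracket k = 0) ∧
    -- the Maurer-Cartan elements are exactly the modified Rota-Baxter operators of weight `λ`,
    -- a linear map `D : A → A` being regarded as an element of `Hom(⊗^1 A, A)`
    ((2 : K) ≠ 0 → ∀ x : Cochains K A A,
      IsMaurerCartan (cochainGrading K A A) (sumM A lam).derivedBracket x ↔
        ∃ D : A →ₗ[K] A, IsModifiedRotaBaxter lam D ∧
          x = DirectSum.lof K ℕ (Cochain K A A) 0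
            (MultilinearMap.ofSubsingleton K A A (0 : Fin 1) D)) := by
  refine ⟨isCurvedLInfty_sumM lam, derivedBracket_zero_apply lam, derivedBracket_one lam,
    fun p q f g x => derivedBracket_two_apply_window lam f g x,
    fun k hk => derivedBracket_eq_zero lam (by omega) (by omega), fun h2 x => ⟨fun hx => ?_, ?_⟩⟩
  -- A Maurer-Cartan element has degree `0`, so it is a single unary cochain, that is, a linear map.
  · obtain ⟨f, rfl⟩ := mem_cochainGrading_natCast.1 hx.1
    obtain ⟨D, rfl⟩ := (MultilinearMap.ofSubsingleton K A A (0 : Fin 1)).surjective f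
    exact ⟨D, (isMaurerCartan_linearMap_iff h2 lam D).1 hx, rfl⟩
  · rintro ⟨D, hD, rfl⟩
    exact (isMaurerCartan_linearMap_iff h2 lam D).2 hD
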